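/- **Setting.** Let $\mathbb F\in\{\mathbb R,\mathbb C\}$, let $M$ be a Hausdorff smooth manifold and $R=C_c^\infty(M)$ the algebra of $\mathbb F$-valued smooth functions with compact support. A *Hopf algebroid* over $R$ is an associative $\mathbb F$-algebra $A$, perhaps without identity, which contains $R$ as a subalgebra and has local identities in $R$ (for $a_1,\dots,a_k\in A$ there is $r\in R$ with $ra_i=a_ir=a_i$ for all $i$), together with $\mathbb F$-linear maps $\Delta:A\to A\otimes_R^{ll}A$ (tensor product over the left $R$-actions), $\epsilon:A\to R$, $S:A\to A$ such that: $\Delta,\epsilon$ are left $R$-linear with $(\mathrm{id}\otimes\epsilon)\Delta=\mathrm{id}=(\epsilon\otimes\mathrm{id})\Delta$; $\epsilon|_R=\mathrm{id}$, $\Delta|_R$ is the canonical embedding $R\cong R\otimes_RR\subset A\otimes_R^{ll}A$, and the two right $R$-actions on $A\otimes^{ll}_RA$ coincide on $\Delta A$; $\Delta(ab)=\Delta(a)\Delta(b)$; $S|_R=\mathrm{id}$, $S^2=\mathrm{id}$, $S(ab)=S(b)S(a)$; and $\mu\circ(S\otimes\mathrm{id})\circ\Delta=\epsilon\circ S$,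 where $\mu$ is the multiplication. A homomorphism of Hopf algebroids over $R$ is an algebra homomorphism which is the identity on $R$ and commutes with $\Delta,\epsilon,S$. For $x\in M$ let $A_x=A/N_x(A)$, where $N_x(A)$ is the set of $a\in A$ with $fa=0$ for some $f\in R$ equal to $1$ near $x$, and let $a_x$ be the class of $a$. Then $A_x$ is a coalgebra, with the induced maps $\Delta_x,\epsilon_x$, over the ring $R_x$ of germs at $x$; let $G(A_x)=\{\zeta\in A_x:\Delta_x\zeta=\zeta\otimes\zeta,\ \epsilon_x\zeta=1\}$. An element $a\in A$ is *normalized at* $x$ if $\epsilon(a)=1$ near $x$, and normalized on $W\subset M$ if it is normalized at each point of $W$; it is *weakly grouplike* if $\Delta(a)=a\otimes a'$ for some $a'\in A$, and *$S$-invariant weakly grouplike* ($a\in G^S_w(A)$) if for some $a'\in A$ both $\Delta(a)=a\otimes a'$ and $\Delta(S(a))=S(a')\otimes S(a)$. The *spectral sheaf* $\mathcal E_{sp}(A)$ over $M$ has stalks $G(A_x)$ and the topology generated by the sets $c_W=\{c_x: x\in W\}$, for $W\subset M$ open and $c$ weakly grouplike and normalized on $W$; a homomorphism $\alpha$ induces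 $\mathcal E_{sp}(\alpha)$, $c_x\mapsto\alpha(c)_x$. Let $\mathcal G_{sp}(A)\subset\mathcal E_{sp}(A)$ be the subspace of *arrows*, i.e. of the elements $a_y\in G(A_y)$ with $a\in G^S_w(A)$ normalized at $y$. For $a\in G^S_w(A)$ put $T_a(f)=\epsilon(S(fa))$, $f\in R$. An *étale Lie groupoid* over $M$ is a groupoid with objects $M$ whose space of arrows is a (not necessarily Hausdorff) smooth manifold and whose source, target, unit, inverse and multiplication maps are local diffeomorphisms. A morphism of étale Lie groupoids over $M$ is a smooth map which preserves source, target, units and multiplication. **Theorem.** Let $A$ be a Hopf algebroid over $C_c^\infty(M)$. 1. If $a\in G^S_w(A)$ is normalized on an open $W\subset M$, there are a unique open $V\subset M$ and a unique diffeomorphism $\tau_{W,a}:V\to W$ with $T_a(C_c^\infty(W))=C_c^\infty(V)$ and $T_a(f)=f\circ\tau_{W,a}$ on $V$ for all $f\in C_c^\infty(W)$. 2. $\mathcal G_{sp}(A)$ is open in $\mathcal E_{sp}(A)$, and the sets $a_W$, for $a\in G^S_w(A)$ normalized on an open $W$, form a basis of its topology. Whenever $a\in G_w^S(A)$ is normalized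 at $y$, the class $a_y$ is an arrow. 3. $\mathcal G_{sp}(A)$ is an étale Lie groupoid over $M$ with the following (well defined) structure maps. The target of $a_y$ is $y$ (so the smooth structure is the one for which the sheaf projection is a local diffeomorphism). The source of $a_y$ is $\tau_{W,a}^{-1}(y)$ for any open $W\ni y$ on which $a$ is normalized. The product is $b_z\,a_y=(ba)_z$ when the source of $b_z$ is $y$. The unit at $y$ is $f_y$ for any $f\in C_c^\infty(M)$ equal to $1$ near $y$. The inverse is $(a_y)^{-1}=(S(a))_x$, where $x$ is the source of $a_y$. 4. For any homomorphism $\alpha:A\to B$ of Hopf algebroids over $C_c^\infty(M)$, $\mathcal E_{sp}(\alpha)$ restricts to a morphism of étale Lie groupoids $\mathcal G_{sp}(\alpha):\mathcal G_{sp}(A)\to\mathcal G_{sp}(B)$, and this gives a functor from the category of Hopf algebroids over $C_c^\infty(M)$ to the category of étale Lie groupoids over $M$. -/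

import Mathlib

open Filter Topology TensorProduct TopologicalSpace CategoryTheory
open scoped Manifold ContDiff

universe u v w

noncomputable section

/-! ## Balanced tensor products over a ring without identity -/

section Balanced

variable {𝕜 : Type*} [Field 𝕜] {R : Type*} {P : Type*} [AddCommGroup P] [Module 𝕜 P]
  {Q : Type*} [AddCommGroup Q] [Module 𝕜 Q]

/-- The subspace of `P ⊗ P` spanned by all `r p ⊗ q - p ⊗ r q`, where `r p` is `act r p`. -/
def balancedSubmodule (act : R → P →ₗ[𝕜] P) : Submodule 𝕜 (P ⊗[𝕜] P) :=
  Submodule.span 𝕜 {z | ∃ (r : R) (p q : P), z = act r p ⊗ₜ[𝕜] q - p ⊗ₜ[𝕜] act r q}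

/-- The tensor product `P ⊗_R P` of an `R`-module (with the action `act`) with itself, as the
quotient of the tensor product over the base field. -/
abbrev BalancedTensor (act : R → P →ₗ[𝕜] P) : Type _ := (P ⊗[𝕜] P) ⧸ balancedSubmodule act

/-- The class of the tensor `p ⊗ q`. -/
def BalancedTensor.tmul (act : R → P →ₗ[𝕜] P) (p q : P) : BalancedTensor act :=
  (balancedSubmodule act).mkQ (p ⊗ₜ[𝕜] q)

/-- The map `f ⊗ g : P ⊗_R P → Q ⊗_R Q` induced by two `R`-linear maps. -/
def BalancedTensor.map {actP : R → P →ₗ[𝕜] P} {actQ : R → Q →ₗ[𝕜] Q} (f g : P →ₗ[𝕜] Q)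
    (hf : ∀ r p, f (actP r p) = actQ r (f p)) (hg : ∀ r p, g (actP r p) = actQ r (g p)) :
    BalancedTensor actP →ₗ[𝕜] BalancedTensor actQ :=
  (balancedSubmodule actP).mapQ (balancedSubmodule actQ) (TensorProduct.map f g) (by
    rw [balancedSubmodule, Submodule.span_le]
    rintro z ⟨r, p, q, rfl⟩
    refine Submodule.subset_span ⟨r, f p, g q, ?_⟩
    simp [hf, hg])

theorem BalancedTensor.map_tmul {actP : R → P →ₗ[𝕜] P} {actQ : R → Q →ₗ[𝕜] Q}
    (f g : P →ₗ[𝕜] Q)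
    (hf : ∀ r p, f (actP r p) = actQ r (f p)) (hg : ∀ r p, g (actP r p) = actQ r (g p))
    (p q : P) : BalancedTensor.map f g hf hg (BalancedTensor.tmul actP p q) =
      BalancedTensor.tmul actQ (f p) (g q) := rfl

/-- Every element of `P ⊗_R P` is the class of an element of `P ⊗ P`; two linear maps which
agree on the classes of elementary tensors agree. -/
theorem BalancedTensor.hom_ext {act : R → P →ₗ[𝕜] P} {f g : BalancedTensor act →ₗ[𝕜] Q}
    (h : ∀ p q, f (BalancedTensor.tmul act p q) = g (BalancedTensor.tmul act p q)) : f = g := by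
  refine Submodule.linearMap_qext _ (TensorProduct.ext' fun p q => h p q)

end Balanced

/-! ## Hopf algebroids over a commutative algebra, possibly without identity -/

section Bimodule

variable {𝕜 : Type*} [Field 𝕜] {R : Type*} [NonUnitalCommRing R] [Module 𝕜 R]
  {A : Type*} [NonUnitalRing A] [Module 𝕜 A] [IsScalarTower 𝕜 A A] [SMulCommClass 𝕜 A A]

/-- The left action `a ↦ r a` of the subalgebra `R` on `A`. -/
def leftAct (ι : R →ₙₐ[𝕜] A) (r : R) : A →ₗ[𝕜] A := LinearMap.mulLeft 𝕜 (ι r)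

/-- The right action `a ↦ a r` of the subalgebra `R` on `A`. -/
def rightAct (ι : R →ₙₐ[𝕜] A) (r : R) : A →ₗ[𝕜] A := LinearMap.mulRight 𝕜 (ι r)

theorem leftAct_comm (ι : R →ₙₐ[𝕜] A) (r s : R) (a : A) :
    leftAct ι r (leftAct ι s a) = leftAct ι s (leftAct ι r a) := by
  simp only [leftAct, LinearMap.mulLeft_apply]
  rw [← mul_assoc, ← mul_assoc, ← map_mul, ← map_mul, mul_comm]

theorem rightAct_leftAct (ι : R →ₙₐ[𝕜] A) (r s : R) (a : A) :
    rightAct ι r (leftAct ι s a) = leftAct ι s (rightAct ι r a) := by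
  simp only [leftAct, rightAct, LinearMap.mulLeft_apply, LinearMap.mulRight_apply, mul_assoc]

/-- The tensor product `A ⊗ A` with respect to the left action of `R` on both factors. -/
abbrev TensorLL (ι : R →ₙₐ[𝕜] A) : Type _ := BalancedTensor (leftAct ι)

/-- The class in `TensorLL ι` of an element of the tensor product over the base field. -/
def TensorLL.mk (ι : R →ₙₐ[𝕜] A) : A ⊗[𝕜] A →ₗ[𝕜] TensorLL ι :=
  (balancedSubmodule (leftAct ι)).mkQ

/-- The left action of `R` on `TensorLL ι`: `r (a ⊗ b) = r a ⊗ b`. -/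
def TensorLL.left (ι : R →ₙₐ[𝕜] A) (r : R) : TensorLL ι →ₗ[𝕜] TensorLL ι :=
  BalancedTensor.map (leftAct ι r) LinearMap.id (fun s a => leftAct_comm ι r s a)
    (fun _ _ => rfl)

/-- The first right action of `R` on `TensorLL ι`: `(a ⊗ b) r = a r ⊗ b`. -/
def TensorLL.rightFst (ι : R →ₙₐ[𝕜] A) (r : R) : TensorLL ι →ₗ[𝕜] TensorLL ι :=
  BalancedTensor.map (rightAct ι r) LinearMap.id (fun s a => rightAct_leftAct ι r s a)
    (fun _ _ => rfl)

/-- The second right action of `R` on `TensorLL ι`: `(a ⊗ b) r = a ⊗ b r`. -/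
def TensorLL.rightSnd (ι : R →ₙₐ[𝕜] A) (r : R) : TensorLL ι →ₗ[𝕜] TensorLL ι :=
  BalancedTensor.map LinearMap.id (rightAct ι r) (fun _ _ => rfl)
    (fun s a => rightAct_leftAct ι r s a)

end Bimodule

/-- A Hopf algebroid over a commutative `𝕜`-algebra `R`: an associative `𝕜`-algebra (perhaps
without identity) which contains `R` as a subalgebra (through `ι`), has local identities in `R`,
and carries a comultiplication, a counit and an antipode.

The maps `id ⊗ ε`, `ε ⊗ id`, `μ ∘ (S ⊗ id)` and the product of `ΔA` with `TensorLL ι` are all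
induced from the tensor product over `𝕜`; the corresponding axioms are written for all
representatives `X ∈ A ⊗ A` of the tensors concerned. -/
structure HopfAlgebroid (𝕜 : Type*) [Field 𝕜] (R : Type*) [NonUnitalCommRing R] [Module 𝕜 R] where
  /-- the underlying algebra -/
  carrier : Type v
  [ring : NonUnitalRing carrier]
  [module : Module 𝕜 carrier]
  [scalarTower : IsScalarTower 𝕜 carrier carrier]
  [smulComm : SMulCommClass 𝕜 carrier carrier]
  /-- the inclusion of the commutative subalgebra -/
  ι : R →ₙₐ[𝕜] carrier
  ι_injective : Function.Injective ι
  local_identities : ∀ s : Finset carrier, ∃ r : R, ∀ a ∈ s, ι r * a = a ∧ a * ι r = a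
  /-- the comultiplication -/
  comul : carrier →ₗ[𝕜] TensorLL ι
  /-- the counit -/
  counit : carrier →ₗ[𝕜] R
  /-- the antipode -/
  antipode : carrier →ₗ[𝕜] carrier
  comul_left : ∀ r a, comul (ι r * a) = TensorLL.left ι r (comul a)
  counit_left : ∀ r a, counit (ι r * a) = r * counit a
  id_tensor_counit : ∀ a X, TensorLL.mk ι X = comul a →
    TensorProduct.lift ((LinearMap.mul 𝕜 carrier).flip.compl₂
      ((ι : R →ₗ[𝕜] carrier) ∘ₗ counit)) X = a
  counit_tensor_id : ∀ a X, TensorLL.mk ι X = comul a →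
    TensorProduct.lift ((LinearMap.mul 𝕜 carrier) ∘ₗ ((ι : R →ₗ[𝕜] carrier) ∘ₗ counit)) X = a
  counit_ι : ∀ r, counit (ι r) = r
  comul_ι : ∀ r s, comul (ι (r * s)) = TensorLL.mk ι (ι r ⊗ₜ[𝕜] ι s)
  rightFst_comul : ∀ r a, TensorLL.rightFst ι r (comul a) = TensorLL.rightSnd ι r (comul a)
  comul_mul : ∀ a b X Y, TensorLL.mk ι X = comul a → TensorLL.mk ι Y = comul b →
    comul (a * b) = TensorLL.mk ι (X * Y)
  antipode_ι : ∀ r, antipode (ι r) = ι r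
  antipode_antipode : ∀ a, antipode (antipode a) = a
  antipode_mul : ∀ a b, antipode (a * b) = antipode b * antipode a
  mul_antipode : ∀ a X, TensorLL.mk ι X = comul a →
    TensorProduct.lift ((LinearMap.mul 𝕜 carrier) ∘ₗ antipode) X = ι (counit (antipode a))

attribute [instance] HopfAlgebroid.ring HopfAlgebroid.module HopfAlgebroid.scalarTower
  HopfAlgebroid.smulComm

namespace HopfAlgebroid

section General

variable {𝕜 : Type*} [Field 𝕜] {R : Type*} [NonUnitalCommRing R] [Module 𝕜 R]

/-- A homomorphism of Hopf algebroids over `R`. -/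
@[ext]
structure Hom (A B : HopfAlgebroid.{v} 𝕜 R) where
  /-- the underlying homomorphism of algebras -/
  toAlgHom : A.carrier →ₙₐ[𝕜] B.carrier
  map_ι : ∀ r, toAlgHom (A.ι r) = B.ι r
  counit_map : ∀ a, B.counit (toAlgHom a) = A.counit a
  comul_map : ∀ a, B.comul (toAlgHom a) =
    BalancedTensor.map (toAlgHom : A.carrier →ₗ[𝕜] B.carrier)
      (toAlgHom : A.carrier →ₗ[𝕜] B.carrier)
      (fun r b => by simp [leftAct, map_ι]) (fun r b => by simp [leftAct, map_ι]) (A.comul a)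
  antipode_map : ∀ a, B.antipode (toAlgHom a) = toAlgHom (A.antipode a)

/-- The identity homomorphism. -/
def Hom.id (A : HopfAlgebroid.{v} 𝕜 R) : Hom A A where
  toAlgHom := NonUnitalAlgHom.id 𝕜 A.carrier
  map_ι _ := rfl
  counit_map _ := rfl
  comul_map a := by
    refine LinearMap.congr_fun (f := LinearMap.id) ?_ (A.comul a)
    exact BalancedTensor.hom_ext fun p q => rfl
  antipode_map _ := rfl

/-- The composition of homomorphisms. -/
def Hom.comp {A B C : HopfAlgebroid.{v} 𝕜 R} (α : Hom A B) (β : Hom B C) : Hom A C where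
  toAlgHom := β.toAlgHom.comp α.toAlgHom
  map_ι r := by simp [α.map_ι, β.map_ι]
  counit_map a := by simp [α.counit_map, β.counit_map]
  comul_map a := by
    rw [NonUnitalAlgHom.comp_apply, β.comul_map, α.comul_map]
    rw [← LinearMap.comp_apply]
    refine LinearMap.congr_fun ?_ (A.comul a)
    exact BalancedTensor.hom_ext fun p q => rfl
  antipode_map a := by simp [α.antipode_map, β.antipode_map]

/-- The category of Hopf algebroids over `R`. -/
instance : Category (HopfAlgebroid.{v} 𝕜 R) where
  Hom := Hom
  id := Hom.id
  comp := Hom.comp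
  id_comp _ := rfl
  comp_id _ := rfl
  assoc _ _ _ := rfl

variable (A : HopfAlgebroid.{v} 𝕜 R)

/-- The tensor `a ⊗ b` over the left action of `R` on both factors. -/
def tmul (a b : A.carrier) : TensorLL A.ι := BalancedTensor.tmul (leftAct A.ι) a b

/-- The weakly grouplike elements: `Δ a = a ⊗ a'` for some `a'`. -/
def weaklyGrouplike : Set A.carrier := {a | ∃ a', A.comul a = A.tmul a a'}

/-- The `S`-invariant weakly grouplike elements: `Δ a = a ⊗ a'` and `Δ (S a) = S a' ⊗ S a` for
some `a'`. -/
def invariantWeaklyGrouplike : Set A.carrier :=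
  {a | ∃ a', A.comul a = A.tmul a a' ∧
    A.comul (A.antipode a) = A.tmul (A.antipode a') (A.antipode a)}

/-- The map `T_a : R → R`, `T_a f = ε (S (f a))`. -/
def T (a : A.carrier) : R →ₗ[𝕜] R :=
  A.counit ∘ₗ A.antipode ∘ₗ LinearMap.mulRight 𝕜 a ∘ₗ (A.ι : R →ₗ[𝕜] A.carrier)

variable {A}

theorem Hom.map_invariantWeaklyGrouplike {B : HopfAlgebroid.{v} 𝕜 R} (α : A ⟶ B)
    {a : A.carrier} (ha : a ∈ A.invariantWeaklyGrouplike) :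
    Hom.toAlgHom α a ∈ B.invariantWeaklyGrouplike := by
  obtain ⟨a', h₁, h₂⟩ := ha
  refine ⟨Hom.toAlgHom α a', ?_, ?_⟩
  · rw [Hom.comul_map, h₁]; rfl
  · rw [Hom.antipode_map, Hom.antipode_map, Hom.comul_map, h₂]; rfl

end General

end HopfAlgebroid

/-! ## Smooth functions with compact support -/

/-- The algebra of `𝕜`-valued smooth functions with compact support on a manifold modelled
on `E`. -/
def SmoothCc (𝕜 : Type*) [RCLike 𝕜] (E : Type*) [NormedAddCommGroup E] [NormedSpace ℝ E]
    (M : Type*) [TopologicalSpace M] [ChartedSpace E M] : NonUnitalSubalgebra 𝕜 (M → 𝕜) where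
  carrier := {f | ContMDiff 𝓘(ℝ, E) 𝓘(ℝ, 𝕜) ∞ f ∧ HasCompactSupport f}
  add_mem' hf hg := ⟨hf.1.add hg.1, hf.2.add hg.2⟩
  zero_mem' := ⟨contMDiff_const, HasCompactSupport.zero⟩
  mul_mem' hf hg :=
    ⟨(contDiff_mul (𝕜 := ℝ) (𝔸 := 𝕜)).contMDiff.comp (hf.1.prodMk_space hg.1), hf.2.mul_right⟩
  smul_mem' c f hf := by
    refine ⟨(contDiff_mul (𝕜 := ℝ) (𝔸 := 𝕜)).contMDiff.comp
      ((contMDiff_const (c := c)).prodMk_space hf.1), ?_⟩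
    exact HasCompactSupport.mul_left (f := fun _ => c) hf.2

section Manifold

variable {𝕜 : Type*} [RCLike 𝕜] {E : Type*} [NormedAddCommGroup E] [NormedSpace ℝ E]
  {M : Type u} [TopologicalSpace M] [ChartedSpace E M]

/-- The subset of the functions whose support is a (compact) subset of `W`; for an open `W` this
is the algebra of smooth functions with compact support on `W`, extended by zero. -/
def SmoothCc.supportedIn (W : Opens M) : Set (SmoothCc 𝕜 E M) := {f | tsupport f.1 ⊆ W}

/-- `f` equals `1` on a neighbourhood of `x`, i.e. the germ of `f` at `x` is `1`. -/
def SmoothCc.GermOne (f : SmoothCc 𝕜 E M) (x : M) : Prop := ∀ᶠ y in 𝓝 x, f.1 y = 1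

/-- The germ at `x`, as a linear map. -/
def SmoothCc.germ (x : M) : SmoothCc 𝕜 E M →ₗ[𝕜] Germ (𝓝 x) 𝕜 where
  toFun f := (f.1 : Germ (𝓝 x) 𝕜)
  map_add' _ _ := rfl
  map_smul' _ _ := rfl

theorem SmoothCc.exists_germOne [FiniteDimensional ℝ E] [T2Space M] [IsManifold 𝓘(ℝ, E) ∞ M]
    {x : M} {U : Set M} (hU : U ∈ 𝓝 x) :
    ∃ f : SmoothCc 𝕜 E M, SmoothCc.GermOne f x ∧ ∀ y, f.1 y ≠ 0 → y ∈ U := by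
  obtain ⟨b, hb⟩ : ∃ b : SmoothBumpFunction 𝓘(ℝ, E) x, Function.support b ⊆ U := by
    obtain ⟨b, -, hb⟩ := (SmoothBumpFunction.nhds_basis_support (I := 𝓘(ℝ, E)) hU).mem_iff.1 hU
    exact ⟨b, hb⟩
  refine ⟨⟨fun y => ((b y : ℝ) : 𝕜), ?_, ?_⟩, ?_, ?_⟩
  · have h : ContMDiff 𝓘(ℝ, ℝ) 𝓘(ℝ, 𝕜) ∞ (fun t : ℝ => (t : 𝕜)) :=
      (RCLike.ofRealCLM (K := 𝕜)).contDiff.contMDiff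
    exact h.comp b.contMDiff
  · exact b.hasCompactSupport.comp_left (g := fun t : ℝ => (t : 𝕜)) (by simp)
  · filter_upwards [b.eventuallyEq_one] with y hy
    simp [hy]
  · intro y hy
    apply hb
    intro h0
    apply hy
    simp [h0]

end Manifold

/-! ## The local coalgebras, the spectral sheaf and the arrows of a Hopf algebroid -/

namespace HopfAlgebroid

section Spectral

variable {𝕜 : Type*} [RCLike 𝕜] {E : Type*} [NormedAddCommGroup E] [NormedSpace ℝ E]
  [FiniteDimensional ℝ E] {M : Type u} [TopologicalSpace M] [T2Space M] [ChartedSpace E M]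
  [IsManifold 𝓘(ℝ, E) ∞ M] (A : HopfAlgebroid.{v} 𝕜 (SmoothCc 𝕜 E M))

/-- The subspace `N_x(A)` of all `a` with `f a = 0` for some `f` which equals `1` near `x`. -/
def germKer (x : M) : Submodule 𝕜 A.carrier where
  carrier := {a | ∃ f : SmoothCc 𝕜 E M, SmoothCc.GermOne f x ∧ A.ι f * a = 0}
  zero_mem' := by
    obtain ⟨f, hf, -⟩ := SmoothCc.exists_germOne (𝕜 := 𝕜) (E := E) (x := x) univ_mem
    exact ⟨f, hf, mul_zero _⟩
  add_mem' := by
    rintro a b ⟨f, hf, hfa⟩ ⟨g, hg, hgb⟩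
    refine ⟨f * g, ?_, ?_⟩
    · filter_upwards [hf, hg] with y h₁ h₂
      change f.1 y * g.1 y = 1
      rw [h₁, h₂, one_mul]
    · rw [mul_add, map_mul, mul_assoc (A.ι f) (A.ι g) b, hgb, ← map_mul, mul_comm f g, map_mul,
        mul_assoc, hfa, mul_zero, mul_zero, add_zero]
  smul_mem' := by
    rintro c a ⟨f, hf, hfa⟩
    exact ⟨f, hf, by rw [mul_smul_comm, hfa, smul_zero]⟩

/-- The localization `A_x = A / N_x(A)`. -/
abbrev Stalk (x : M) : Type v := A.carrier ⧸ A.germKer x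

/-- The class `a_x` of `a` in `A_x`. -/
def germ (x : M) : A.carrier →ₗ[𝕜] A.Stalk x := (A.germKer x).mkQ

/-- The left action of `R` on `A_x`. -/
def stalkAct (x : M) (r : SmoothCc 𝕜 E M) : A.Stalk x →ₗ[𝕜] A.Stalk x :=
  (A.germKer x).mapQ (A.germKer x) (leftAct A.ι r) (by
    rintro a ⟨f, hf, hfa⟩
    refine ⟨f, hf, ?_⟩
    change A.ι f * (A.ι r * a) = 0
    rw [← mul_assoc, ← map_mul, mul_comm f r, map_mul, mul_assoc, hfa, mul_zero])

theorem stalkAct_of_germOne {x : M} {f : SmoothCc 𝕜 E M}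
    (hf : SmoothCc.GermOne f x) (ζ : A.Stalk x) :
    A.stalkAct x f ζ = ζ := by
  obtain ⟨a, rfl⟩ := (A.germKer x).mkQ_surjective ζ
  obtain ⟨q, hq, hqf⟩ := SmoothCc.exists_germOne (𝕜 := 𝕜) (E := E) hf
  have h : q * f = q := by
    ext y
    change q.1 y * f.1 y = q.1 y
    by_cases hy : q.1 y = 0
    · rw [hy, zero_mul]
    · have : f.1 y = 1 := hqf y hy
      rw [this, mul_one]
  change (A.germKer x).mkQ (A.ι f * a) = (A.germKer x).mkQ a
  rw [← sub_eq_zero, ← map_sub, Submodule.mkQ_apply, Submodule.Quotient.mk_eq_zero]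
  refine ⟨q, hq, ?_⟩
  rw [mul_sub, ← mul_assoc, ← map_mul, h, sub_self]

/-- The tensor product `A_x ⊗ A_x` over `R`; since `R → R_x` is surjective, it is also the tensor
product over the ring `R_x` of germs. -/
abbrev StalkTensor (x : M) : Type _ := BalancedTensor (A.stalkAct x)

/-- The map `A ⊗ A → A_x ⊗ A_x` between tensor products over `R`. -/
def germTensor (x : M) : TensorLL A.ι →ₗ[𝕜] A.StalkTensor x :=
  BalancedTensor.map (A.germ x) (A.germ x) (fun _ _ => rfl) (fun _ _ => rfl)

theorem germTensor_left {x : M} {f : SmoothCc 𝕜 E M}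
    (hf : SmoothCc.GermOne f x) (z : TensorLL A.ι) :
    A.germTensor x (TensorLL.left A.ι f z) = A.germTensor x z := by
  rw [← LinearMap.comp_apply]
  refine LinearMap.congr_fun (BalancedTensor.hom_ext fun p q => ?_) z
  change BalancedTensor.tmul _ (A.stalkAct x f (A.germ x p)) (A.germ x q) = _
  rw [A.stalkAct_of_germOne hf]
  rfl

/-- The comultiplication `Δ_x : A_x → A_x ⊗ A_x` of the local coalgebra at `x`. -/
def stalkComul (x : M) : A.Stalk x →ₗ[𝕜] A.StalkTensor x :=
  (A.germKer x).liftQ (A.germTensor x ∘ₗ A.comul) (by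
    rintro a ⟨f, hf, hfa⟩
    rw [LinearMap.mem_ker, LinearMap.comp_apply, ← A.germTensor_left hf, ← A.comul_left, hfa,
      map_zero, map_zero])

/-- The counit `ε_x : A_x → R_x` of the local coalgebra at `x`. -/
def stalkCounit (x : M) : A.Stalk x →ₗ[𝕜] Germ (𝓝 x) 𝕜 :=
  (A.germKer x).liftQ (SmoothCc.germ x ∘ₗ A.counit) (by
    rintro a ⟨f, hf, hfa⟩
    have h : f * A.counit a = 0 := by rw [← A.counit_left, hfa, map_zero]
    rw [LinearMap.mem_ker, LinearMap.comp_apply]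
    refine Germ.coe_eq.2 ?_
    filter_upwards [hf] with y hy
    have h' : f.1 y * (A.counit a).1 y = 0 := congrFun (congrArg Subtype.val h) y
    rwa [hy, one_mul] at h')

/-- The grouplike elements of the local coalgebra `A_x`. -/
def grouplike (x : M) : Set (A.Stalk x) :=
  {ζ | A.stalkComul x ζ = BalancedTensor.tmul (A.stalkAct x) ζ ζ ∧ A.stalkCounit x ζ = 1}

/-- `a` is normalized at `x`: the function `ε a` equals `1` near `x`. -/
def NormalizedAt (a : A.carrier) (x : M) : Prop := SmoothCc.GermOne (A.counit a) x

/-- `a` is normalized on `W`. -/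
def NormalizedOn (a : A.carrier) (W : Opens M) : Prop := ∀ x ∈ W, A.NormalizedAt a x

/-- The (total space of the) spectral sheaf: its stalk at `x` is the set of grouplike elements
of `A_x`. -/
def SpectralSheaf : Type (max u v) := Σ x : M, A.grouplike x

variable {A} in
/-- The projection of the spectral sheaf. -/
def SpectralSheaf.proj (ζ : A.SpectralSheaf) : M := ζ.1

variable {A} in
/-- The grouplike element of the stalk given by a point of the spectral sheaf. -/
def SpectralSheaf.val (ζ : A.SpectralSheaf) : A.Stalk ζ.proj := ζ.2.1

/-- The subset `c_W` of the spectral sheaf, consisting of the germs `c_x`, `x ∈ W`. -/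
def basicSet (c : A.carrier) (W : Opens M) : Set A.SpectralSheaf :=
  {ζ | ζ.proj ∈ W ∧ ζ.val = A.germ ζ.proj c}

/-- The topology of the spectral sheaf: it is generated by the sets `c_W`, for `c` weakly
grouplike and normalized on an open subset `W`. -/
instance : TopologicalSpace A.SpectralSheaf :=
  TopologicalSpace.generateFrom
    {s | ∃ (c : A.carrier) (W : Opens M), c ∈ A.weaklyGrouplike ∧ A.NormalizedOn c W ∧
      s = A.basicSet c W}

/-- The arrows: the elements of the spectral sheaf of the form `a_y`, for an `S`-invariant
weakly grouplike element `a` normalized at `y`. -/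
def arrows : Set A.SpectralSheaf :=
  {ζ | ∃ a ∈ A.invariantWeaklyGrouplike, A.NormalizedAt a ζ.proj ∧ ζ.val = A.germ ζ.proj a}

/-- The sheaf of arrows, with the topology of a subspace of the spectral sheaf. -/
abbrev Gsp : Type (max u v) := A.arrows

variable {A} in
/-- `g` is the arrow `a_y` represented by the `S`-invariant weakly grouplike element `a`
normalized at the target `y` of `g`. -/
def Gsp.IsRepresentedBy (g : A.Gsp) (a : A.carrier) : Prop :=
  a ∈ A.invariantWeaklyGrouplike ∧ A.NormalizedAt a g.1.proj ∧ g.1.val = A.germ g.1.proj a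

/-- The diffeomorphism `τ : V → W` is induced by `T_a`: it satisfies
`T_a (C_c^∞(W)) = C_c^∞(V)` and `T_a f = f ∘ τ` for all `f ∈ C_c^∞(W)`. -/
structure IsInduced (a : A.carrier) (W V : Opens M)
    (τ : Diffeomorph 𝓘(ℝ, E) 𝓘(ℝ, E) V W ∞) : Prop where
  image_eq : A.T a '' SmoothCc.supportedIn W = SmoothCc.supportedIn V
  apply_eq : ∀ f ∈ SmoothCc.supportedIn (𝕜 := 𝕜) (E := E) W, ∀ x : V,
    (A.T a f).1 x = f.1 (τ x)

variable {A} {B : HopfAlgebroid.{v} 𝕜 (SmoothCc 𝕜 E M)}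

/-- The map `α_x : A_x → B_x` induced by a homomorphism. -/
def stalkMap (α : A ⟶ B) (x : M) : A.Stalk x →ₗ[𝕜] B.Stalk x :=
  (A.germKer x).mapQ (B.germKer x) (Hom.toAlgHom α : A.carrier →ₗ[𝕜] B.carrier) (by
    rintro a ⟨f, hf, hfa⟩
    refine ⟨f, hf, ?_⟩
    change B.ι f * Hom.toAlgHom α a = 0
    rw [← Hom.map_ι α, ← map_mul, hfa, map_zero])

theorem stalkMap_grouplike (α : A ⟶ B) {x : M} {ζ : A.Stalk x} (hζ : ζ ∈ A.grouplike x) :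
    stalkMap α x ζ ∈ B.grouplike x := by
  obtain ⟨h₁, h₂⟩ := hζ
  have hact : ∀ r (ξ : A.Stalk x),
      stalkMap α x (A.stalkAct x r ξ) = B.stalkAct x r (stalkMap α x ξ) := by
    intro r ξ
    obtain ⟨a, rfl⟩ := (A.germKer x).mkQ_surjective ξ
    change B.germ x (Hom.toAlgHom α (A.ι r * a)) = B.germ x (B.ι r * Hom.toAlgHom α a)
    rw [map_mul, Hom.map_ι]
  have key : ∀ ξ : A.Stalk x, B.stalkComul x (stalkMap α x ξ) =
      BalancedTensor.map (stalkMap α x) (stalkMap α x) hact hact (A.stalkComul x ξ) := by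
    intro ξ
    obtain ⟨a, rfl⟩ := (A.germKer x).mkQ_surjective ξ
    change B.germTensor x (B.comul (Hom.toAlgHom α a)) =
      BalancedTensor.map (stalkMap α x) (stalkMap α x) hact hact (A.germTensor x (A.comul a))
    have h : B.germTensor x ∘ₗ BalancedTensor.map (Hom.toAlgHom α : A.carrier →ₗ[𝕜] B.carrier)
        (Hom.toAlgHom α : A.carrier →ₗ[𝕜] B.carrier)
        (actP := leftAct A.ι) (actQ := leftAct B.ι)
        (fun r b => by simp [leftAct, Hom.map_ι]) (fun r b => by simp [leftAct, Hom.map_ι]) =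
      BalancedTensor.map (stalkMap α x) (stalkMap α x) hact hact ∘ₗ A.germTensor x :=
      BalancedTensor.hom_ext fun p q => rfl
    rw [Hom.comul_map]
    exact LinearMap.congr_fun h (A.comul a)
  refine ⟨?_, ?_⟩
  · rw [key, h₁]
    rfl
  · obtain ⟨a, rfl⟩ := (A.germKer x).mkQ_surjective ζ
    rw [← h₂]
    change SmoothCc.germ x (B.counit (Hom.toAlgHom α a)) = SmoothCc.germ x (A.counit a)
    rw [Hom.counit_map]

/-- The map of spectral sheaves induced by a homomorphism: it is `α_x` on the stalk at `x`. -/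
def SpectralSheaf.map (α : A ⟶ B) (ζ : A.SpectralSheaf) : B.SpectralSheaf :=
  ⟨ζ.proj, stalkMap α ζ.proj ζ.val, stalkMap_grouplike α ζ.2.2⟩

/-- The restriction of the map of spectral sheaves to the arrows. -/
def Gsp.map (α : A ⟶ B) (g : A.Gsp) : B.Gsp :=
  ⟨SpectralSheaf.map α g.1, by
    obtain ⟨a, ha, hn, hg⟩ := g.2
    refine ⟨Hom.toAlgHom α a, Hom.map_invariantWeaklyGrouplike α ha, ?_, ?_⟩
    · change SmoothCc.GermOne (B.counit (Hom.toAlgHom α a)) g.1.proj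
      rw [Hom.counit_map]
      exact hn
    · change stalkMap α g.1.proj g.1.val = _
      rw [hg]
      rfl⟩

end Spectral

end HopfAlgebroid

/-! ## Étale Lie groupoids -/

/-- The structure of an étale Lie groupoid over the manifold `M` on a topological space `G`
(not necessarily Hausdorff): a smooth structure on `G` and a groupoid structure with objects `M`
and arrows `G`, all of whose structure maps are local diffeomorphisms.

The smooth structure on the fibred product `{(g, h) | s g = t h}` is the unique one (up to the
choice of an atlas), on the subspace of `G × G`, for which both projections to `G` are local
diffeomorphisms. -/
structure EtaleLieGroupoid (E : Type*) [NormedAddCommGroup E] [NormedSpace ℝ E]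
    (M : Type*) [TopologicalSpace M] [ChartedSpace E M]
    (G : Type w) [TopologicalSpace G] where
  [charted : ChartedSpace E G]
  [isManifold : IsManifold 𝓘(ℝ, E) ∞ G]
  /-- the source map -/
  source : G → M
  /-- the target map -/
  target : G → M
  /-- the unit map -/
  unit : M → G
  /-- the inverse map -/
  inv : G → G
  /-- the multiplication, `mul ⟨(g, h), _⟩ = g h` -/
  mul : {p : G × G // source p.1 = target p.2} → G
  source_unit : ∀ x, source (unit x) = x
  target_unit : ∀ x, target (unit x) = x
  source_inv : ∀ g, source (inv g) = target g
  target_inv : ∀ g, target (inv g) = source g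
  source_mul : ∀ p, source (mul p) = source p.1.2
  target_mul : ∀ p, target (mul p) = target p.1.1
  mul_assoc : ∀ g h k (hgh : source g = target h) (hhk : source h = target k),
    mul ⟨(mul ⟨(g, h), hgh⟩, k), (source_mul _).trans hhk⟩ =
      mul ⟨(g, mul ⟨(h, k), hhk⟩), hgh.trans (target_mul ⟨(h, k), hhk⟩).symm⟩
  unit_mul : ∀ g, mul ⟨(unit (target g), g), source_unit _⟩ = g
  mul_unit : ∀ g, mul ⟨(g, unit (source g)), (target_unit _).symm⟩ = g
  inv_mul : ∀ g, mul ⟨(inv g, g), source_inv g⟩ = unit (source g)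
  mul_inv : ∀ g, mul ⟨(g, inv g), (target_inv g).symm⟩ = unit (target g)
  source_localDiffeo : IsLocalDiffeomorph 𝓘(ℝ, E) 𝓘(ℝ, E) ∞ source
  target_localDiffeo : IsLocalDiffeomorph 𝓘(ℝ, E) 𝓘(ℝ, E) ∞ target
  unit_localDiffeo : IsLocalDiffeomorph 𝓘(ℝ, E) 𝓘(ℝ, E) ∞ unit
  inv_localDiffeo : IsLocalDiffeomorph 𝓘(ℝ, E) 𝓘(ℝ, E) ∞ inv
  mul_localDiffeo : ∃ _ : ChartedSpace E {p : G × G // source p.1 = target p.2},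
    IsManifold 𝓘(ℝ, E) ∞ {p : G × G // source p.1 = target p.2} ∧
    IsLocalDiffeomorph 𝓘(ℝ, E) 𝓘(ℝ, E) ∞
      (fun p : {p : G × G // source p.1 = target p.2} => p.1.1) ∧
    IsLocalDiffeomorph 𝓘(ℝ, E) 𝓘(ℝ, E) ∞
      (fun p : {p : G × G // source p.1 = target p.2} => p.1.2) ∧
    IsLocalDiffeomorph 𝓘(ℝ, E) 𝓘(ℝ, E) ∞ mul

/-- A morphism of étale Lie groupoids over `M`: a smooth map which preserves the groupoid
structure and is the identity on `M`. -/
structure EtaleLieGroupoid.IsMorphism {E : Type*} [NormedAddCommGroup E] [NormedSpace ℝ E]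
    {M : Type*} [TopologicalSpace M] [ChartedSpace E M]
    {G H : Type*} [TopologicalSpace G] [TopologicalSpace H]
    (𝒢 : EtaleLieGroupoid E M G) (ℋ : EtaleLieGroupoid E M H) (φ : G → H) : Prop where
  smooth : letI := 𝒢.charted; letI := ℋ.charted; ContMDiff 𝓘(ℝ, E) 𝓘(ℝ, E) ∞ φ
  map_unit : ∀ x, φ (𝒢.unit x) = ℋ.unit x
  source_map : ∀ g, ℋ.source (φ g) = 𝒢.source g
  target_map : ∀ g, ℋ.target (φ g) = 𝒢.target g
  map_mul : ∀ g h (hgh : 𝒢.source g = 𝒢.target h),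
    φ (𝒢.mul ⟨(g, h), hgh⟩) =
      ℋ.mul ⟨(φ g, φ h), (source_map g).trans (hgh.trans (target_map h).symm)⟩

/-- An étale Lie groupoid over `M`. -/
structure EtGrpd (E : Type*) [NormedAddCommGroup E] [NormedSpace ℝ E]
    (M : Type*) [TopologicalSpace M] [ChartedSpace E M] where
  /-- the space of arrows -/
  Arr : Type w
  [topology : TopologicalSpace Arr]
  /-- the étale Lie groupoid structure -/
  groupoid : EtaleLieGroupoid E M Arr

attribute [instance] EtGrpd.topology

/-- The category of étale Lie groupoids over `M`. -/
instance {E : Type*} [NormedAddCommGroup E] [NormedSpace ℝ E]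
    {M : Type*} [TopologicalSpace M] [ChartedSpace E M] : Category (EtGrpd.{w} E M) where
  Hom 𝒢 ℋ := {φ : 𝒢.Arr → ℋ.Arr // 𝒢.groupoid.IsMorphism ℋ.groupoid φ}
  id 𝒢 := ⟨fun g => g,
    { smooth := by
        let := 𝒢.groupoid.charted
        exact contMDiff_id
      map_unit := fun _ => rfl
      source_map := fun _ => rfl
      target_map := fun _ => rfl
      map_mul := fun _ _ _ => rfl }⟩
  comp {𝒢 ℋ 𝒦} φ ψ := ⟨fun g => ψ.1 (φ.1 g),
    { smooth := by
        let := 𝒢.groupoid.charted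
        let := ℋ.groupoid.charted
        let := 𝒦.groupoid.charted
        exact ψ.2.smooth.comp φ.2.smooth
      map_unit := fun x => by rw [φ.2.map_unit, ψ.2.map_unit]
      source_map := fun g => by rw [ψ.2.source_map, φ.2.source_map]
      target_map := fun g => by rw [ψ.2.target_map, φ.2.target_map]
      map_mul := fun g h hgh => by rw [φ.2.map_mul g h hgh, ψ.2.map_mul] }⟩
  id_comp _ := rfl
  comp_id _ := rfl
  assoc _ _ _ := rfl

/-- The structure maps of the étale Lie groupoid structure `𝒢` on the sheaf of arrows of `A` are
the ones given by the operations of `A`. -/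
structure HopfAlgebroid.IsSpectralGroupoid {𝕜 : Type*} [RCLike 𝕜] {E : Type*}
    [NormedAddCommGroup E] [NormedSpace ℝ E] [FiniteDimensional ℝ E]
    {M : Type u} [TopologicalSpace M] [T2Space M] [ChartedSpace E M] [IsManifold 𝓘(ℝ, E) ∞ M]
    (A : HopfAlgebroid.{v} 𝕜 (SmoothCc 𝕜 E M)) (𝒢 : EtaleLieGroupoid E M A.Gsp) : Prop where
  /-- the target is the projection of the sheaf, `t (a_y) = y` -/
  target_eq : ∀ g, 𝒢.target g = g.1.proj
  /-- the source is `s (a_y) = τ⁻¹ y`, where `τ` is induced by `T_a` -/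
  source_eq : ∀ (g : A.Gsp) (a : A.carrier), g.IsRepresentedBy a →
    ∀ (W V : Opens M) (τ : Diffeomorph 𝓘(ℝ, E) 𝓘(ℝ, E) V W ∞), A.NormalizedOn a W →
      A.IsInduced a W V τ → ∀ hg : g.1.proj ∈ W, 𝒢.source g = τ.symm ⟨g.1.proj, hg⟩
  /-- the unit arrow at `y` is `f_y`, where `f` equals `1` near `y` -/
  unit_eq : ∀ (y : M) (f : SmoothCc 𝕜 E M), SmoothCc.GermOne f y →
    (𝒢.unit y).IsRepresentedBy (A.ι f)
  /-- the product of `b_z` and `a_y` is `(b a)_z` -/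
  mul_eq : ∀ (h g : A.Gsp) (hhg : 𝒢.source h = 𝒢.target g) (b a : A.carrier),
    h.IsRepresentedBy b → g.IsRepresentedBy a →
      Gsp.IsRepresentedBy (𝒢.mul ⟨(h, g), hhg⟩) (b * a)
  /-- the inverse of `a_y` is `(S a)_x`, where `x` is the source of `a_y` -/
  inv_eq : ∀ (g : A.Gsp) (a : A.carrier), g.IsRepresentedBy a →
    Gsp.IsRepresentedBy (𝒢.inv g) (A.antipode a)

end

/-! If `a` is `S`-invariant weakly grouplike with `ε a = 1` at `y`, the relation
`T_{S a} f * T_{S a} g = ε a * T_{S a} (f g)` shows that `g ↦ T_{S a} g (y) = ε (a g) (y)` is a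
nonzero character of `C_c^∞(M)`, hence the evaluation at a point `x`, the source of `a_y`. We say
that `a` links `x` to `y`. This relation depends only on the germ of `a` at `y`; products compose
it and antipodes reverse it, so the groupoid structure can be read off from representatives.

For `a` normalized on `W`, the source map of `a` on `W` has the source map of `S a` as its inverse,
and both are smooth since they pull smooth functions back to smooth functions. This inverse is
`τ_{W, a}`. The unit, the inverse and the product are continuous lifts of local diffeomorphisms
along the target map, which is itself a local diffeomorphism. -/

noncomputable section

namespace HopfAlgebroid

section Algebra

variable {𝕜 : Type*} [Field 𝕜] {R : Type*} [NonUnitalCommRing R] [Module 𝕜 R]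
  {A : HopfAlgebroid.{v} 𝕜 R}

theorem tmul_left (r : R) (a b : A.carrier) : A.tmul (A.ι r * a) b = A.tmul a (A.ι r * b) :=
  (Submodule.Quotient.eq _).2 (Submodule.subset_span ⟨r, a, b, rfl⟩)

theorem ι_counit_mul_fst {a b c : A.carrier} (h : A.comul a = A.tmul b c) :
    A.ι (A.counit c) * b = a :=
  A.id_tensor_counit a (b ⊗ₜ c) h.symm

theorem ι_counit_mul_snd {a b c : A.carrier} (h : A.comul a = A.tmul b c) :
    A.ι (A.counit b) * c = a :=
  A.counit_tensor_id a (b ⊗ₜ c) h.symm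

theorem antipode_fst_mul_snd {a b c : A.carrier} (h : A.comul a = A.tmul b c) :
    A.antipode b * c = A.ι (A.counit (A.antipode a)) :=
  A.mul_antipode a (b ⊗ₜ c) h.symm

theorem comul_ι_mul_eq_tmul {a b c : A.carrier} (r : R) (h : A.comul a = A.tmul b c) :
    A.comul (A.ι r * a) = A.tmul (A.ι r * b) c := by
  rw [A.comul_left, h]
  rfl

theorem comul_mul_eq_tmul {a b c x y z : A.carrier} (h : A.comul a = A.tmul b c)
    (h' : A.comul x = A.tmul y z) : A.comul (a * x) = A.tmul (b * y) (c * z) :=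
  (A.comul_mul a x (b ⊗ₜ c) (y ⊗ₜ z) h.symm h'.symm).trans <|
    congrArg (TensorLL.mk A.ι) (Algebra.TensorProduct.tmul_mul_tmul ..)

theorem T_apply (a : A.carrier) (f : R) : A.T a f = A.counit (A.antipode (A.ι f * a)) := rfl

theorem T_ι (f g : R) : A.T (A.ι f) g = g * f := by
  rw [T_apply, ← map_mul, A.antipode_ι, A.counit_ι]

theorem T_antipode_apply (a : A.carrier) (f : R) :
    A.T (A.antipode a) f = A.counit (a * A.ι f) := by
  rw [T_apply, A.antipode_mul, A.antipode_antipode, A.antipode_ι]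

/-- The defining relations of an `S`-invariant weakly grouplike element `a`, with the second
factor `a'` of `Δ a` made explicit. -/
structure IsInvariantPair (A : HopfAlgebroid.{v} 𝕜 R) (a a' : A.carrier) : Prop where
  comul_eq : A.comul a = A.tmul a a'
  comul_antipode : A.comul (A.antipode a) = A.tmul (A.antipode a') (A.antipode a)

theorem mem_invariantWeaklyGrouplike {a : A.carrier} :
    a ∈ A.invariantWeaklyGrouplike ↔ ∃ a', A.IsInvariantPair a a' :=
  ⟨fun ⟨a', h₁, h₂⟩ => ⟨a', h₁, h₂⟩, fun ⟨a', h⟩ => ⟨a', h.1, h.2⟩⟩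

theorem exists_isInvariantPair_ι (f : R) : ∃ g, A.IsInvariantPair (A.ι f) (A.ι g) := by
  obtain ⟨g, hg⟩ := A.local_identities {A.ι f}
  have hfg : f * g = f := A.ι_injective <| by
    rw [map_mul]
    exact (hg _ (Finset.mem_singleton_self _)).2
  have hfst : A.comul (A.ι f) = A.tmul (A.ι f) (A.ι g) := by
    conv_lhs => rw [← hfg]
    exact A.comul_ι f g
  have hsnd : A.comul (A.ι f) = A.tmul (A.ι g) (A.ι f) := by
    conv_lhs => rw [← hfg, mul_comm]
    exact A.comul_ι g f
  exact ⟨g, hfst, by rwa [A.antipode_ι, A.antipode_ι]⟩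

namespace IsInvariantPair

variable {a a' b b' : A.carrier}

theorem ι_counit_mul (h : A.IsInvariantPair a a') : A.ι (A.counit a) * a' = a :=
  ι_counit_mul_snd h.comul_eq

theorem ι_counit_antipode_mul (h : A.IsInvariantPair a a') :
    A.ι (A.counit (A.antipode a)) * A.antipode a' = A.antipode a :=
  ι_counit_mul_fst h.comul_antipode

theorem antipode (h : A.IsInvariantPair a a') :
    A.IsInvariantPair (A.antipode a) (A.antipode a') where
  comul_eq :=
    calc A.comul (A.antipode a)
        = A.tmul (A.antipode a') (A.ι (A.counit (A.antipode a)) * A.antipode a') := by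
          rw [h.ι_counit_antipode_mul, h.comul_antipode]
      _ = A.tmul (A.antipode a) (A.antipode a') := by
          rw [← tmul_left, h.ι_counit_antipode_mul]
  comul_antipode := by
    rw [A.antipode_antipode, A.antipode_antipode]
    calc A.comul a
        = A.tmul (A.ι (A.counit a) * a') a' := by rw [h.ι_counit_mul, h.comul_eq]
      _ = A.tmul a' a := by rw [tmul_left, h.ι_counit_mul]

theorem mul (hb : A.IsInvariantPair b b') (ha : A.IsInvariantPair a a') :
    A.IsInvariantPair (b * a) (b' * a') where
  comul_eq := comul_mul_eq_tmul hb.comul_eq ha.comul_eq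
  comul_antipode := by
    simp only [A.antipode_mul]
    exact comul_mul_eq_tmul ha.comul_antipode hb.comul_antipode

theorem mul_ι_counit_antipode (h : A.IsInvariantPair a a') :
    a' * A.ι (A.counit (A.antipode a)) = a := by
  simpa only [A.antipode_mul, A.antipode_antipode, A.antipode_ι] using
    congrArg A.antipode h.ι_counit_antipode_mul

theorem snd_mul_antipode (h : A.IsInvariantPair a a') :
    a' * A.antipode a = A.ι (A.counit a) := by
  simpa only [A.antipode_antipode] using antipode_fst_mul_snd h.comul_antipode

theorem ι_T (h : A.IsInvariantPair a a') (f : R) :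
    A.ι (A.T a f) = A.antipode a * A.ι f * a' := by
  rw [T_apply, ← antipode_fst_mul_snd (comul_ι_mul_eq_tmul f h.comul_eq), A.antipode_mul,
    A.antipode_ι]

theorem ι_T_antipode (h : A.IsInvariantPair a a') (f : R) :
    A.ι (A.T (A.antipode a) f) = a' * A.ι f * A.antipode a := by
  simpa only [A.antipode_mul, A.antipode_antipode, A.antipode_ι, mul_assoc] using
    congrArg A.antipode (h.antipode.ι_T f)

end IsInvariantPair

section InvariantWeaklyGrouplike

variable {a b : A.carrier}

theorem invariantWeaklyGrouplike_subset : A.invariantWeaklyGrouplike ⊆ A.weaklyGrouplike :=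
  fun _ ⟨a', h, _⟩ => ⟨a', h⟩

theorem ι_mem_invariantWeaklyGrouplike (f : R) : A.ι f ∈ A.invariantWeaklyGrouplike :=
  let ⟨_, h⟩ := exists_isInvariantPair_ι f
  mem_invariantWeaklyGrouplike.2 ⟨_, h⟩

theorem antipode_mem_invariantWeaklyGrouplike (ha : a ∈ A.invariantWeaklyGrouplike) :
    A.antipode a ∈ A.invariantWeaklyGrouplike :=
  let ⟨_, h⟩ := mem_invariantWeaklyGrouplike.1 ha
  mem_invariantWeaklyGrouplike.2 ⟨_, h.antipode⟩

theorem mul_mem_invariantWeaklyGrouplike (hb : b ∈ A.invariantWeaklyGrouplike)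
    (ha : a ∈ A.invariantWeaklyGrouplike) : b * a ∈ A.invariantWeaklyGrouplike :=
  let ⟨_, h⟩ := mem_invariantWeaklyGrouplike.1 hb
  let ⟨_, h'⟩ := mem_invariantWeaklyGrouplike.1 ha
  mem_invariantWeaklyGrouplike.2 ⟨_, h.mul h'⟩

theorem T_mul_T (ha : a ∈ A.invariantWeaklyGrouplike) (f g : R) :
    A.T a f * A.T a g = A.T a (f * A.counit a * g) := by
  obtain ⟨a', h⟩ := mem_invariantWeaklyGrouplike.1 ha
  apply A.ι_injective
  simp only [h.ι_T, map_mul, ← h.snd_mul_antipode, mul_assoc]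

theorem T_mul_counit_antipode (ha : a ∈ A.invariantWeaklyGrouplike) (f : R) :
    A.T a f * A.counit (A.antipode a) = A.T a (f * A.counit a) := by
  obtain ⟨a', h⟩ := mem_invariantWeaklyGrouplike.1 ha
  apply A.ι_injective
  simp only [h.ι_T, map_mul, mul_assoc, h.mul_ι_counit_antipode, h.ι_counit_mul]

theorem T_antipode_T (ha : a ∈ A.invariantWeaklyGrouplike) (f : R) :
    A.T (A.antipode a) (A.T a f) = A.counit a * f * A.counit a := by
  obtain ⟨a', h⟩ := mem_invariantWeaklyGrouplike.1 ha
  apply A.ι_injective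
  simp only [h.ι_T_antipode, h.ι_T, map_mul, ← h.snd_mul_antipode, mul_assoc]

theorem T_T_antipode (ha : a ∈ A.invariantWeaklyGrouplike) (f : R) :
    A.T a (A.T (A.antipode a) f) = A.counit (A.antipode a) * f * A.counit (A.antipode a) := by
  simpa only [A.antipode_antipode] using
    T_antipode_T (antipode_mem_invariantWeaklyGrouplike ha) f

theorem T_mul (hb : b ∈ A.invariantWeaklyGrouplike) (ha : a ∈ A.invariantWeaklyGrouplike)
    (f : R) : A.T (b * a) f = A.T a (A.T b f) := by
  obtain ⟨a', h⟩ := mem_invariantWeaklyGrouplike.1 ha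
  obtain ⟨b', h'⟩ := mem_invariantWeaklyGrouplike.1 hb
  apply A.ι_injective
  simp only [(h'.mul h).ι_T, h.ι_T, h'.ι_T, A.antipode_mul, mul_assoc]

theorem counit_mul (hb : b ∈ A.invariantWeaklyGrouplike) (ha : a ∈ A.invariantWeaklyGrouplike) :
    A.counit (b * a) = A.T (A.antipode b) (A.counit a) := by
  obtain ⟨a', h⟩ := mem_invariantWeaklyGrouplike.1 ha
  obtain ⟨b', h'⟩ := mem_invariantWeaklyGrouplike.1 hb
  apply A.ι_injective
  simp only [← (h'.mul h).snd_mul_antipode, h'.ι_T_antipode, ← h.snd_mul_antipode,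
    A.antipode_mul, mul_assoc]

theorem self_mul_antipode (ha : a ∈ A.invariantWeaklyGrouplike) :
    a * A.antipode a = A.ι (A.counit a * A.counit a) := by
  obtain ⟨a', h⟩ := mem_invariantWeaklyGrouplike.1 ha
  rw [map_mul]
  nth_rw 2 [← h.snd_mul_antipode]
  rw [← mul_assoc, h.ι_counit_mul]

theorem mul_ι_counit_antipode (ha : a ∈ A.invariantWeaklyGrouplike) :
    a * A.ι (A.counit (A.antipode a)) = A.ι (A.counit a) * a := by
  obtain ⟨a', h⟩ := mem_invariantWeaklyGrouplike.1 ha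
  nth_rw 1 [← h.ι_counit_mul]
  rw [mul_assoc, h.mul_ι_counit_antipode]

theorem ι_T_antipode_mul (ha : a ∈ A.invariantWeaklyGrouplike) (f : R) :
    A.ι (A.T (A.antipode a) f) * a = A.ι (A.counit a) * a * A.ι f := by
  obtain ⟨a', h⟩ := mem_invariantWeaklyGrouplike.1 ha
  have h₁ : A.antipode a * a = A.ι (A.counit (A.antipode a) * A.counit (A.antipode a)) := by
    simpa only [A.antipode_antipode] using
      self_mul_antipode (antipode_mem_invariantWeaklyGrouplike ha)
  calc A.ι (A.T (A.antipode a) f) * a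
      = a' * A.ι (f * (A.counit (A.antipode a) * A.counit (A.antipode a))) := by
        rw [h.ι_T_antipode, mul_assoc, h₁, mul_assoc, ← map_mul]
    _ = a' * A.ι (A.counit (A.antipode a)) * A.ι (A.counit (A.antipode a)) * A.ι f := by
        rw [mul_comm f, map_mul, map_mul]
        simp only [mul_assoc]
    _ = A.ι (A.counit a) * a * A.ι f := by
        rw [h.mul_ι_counit_antipode, HopfAlgebroid.mul_ι_counit_antipode ha]

end InvariantWeaklyGrouplike

end Algebra

end HopfAlgebroid

section LocalHomeomorphisms

variable {X : Type*} [TopologicalSpace X] {Y : Type*} [TopologicalSpace Y]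
  {Z : Type*} [TopologicalSpace Z]

theorem isLocalHomeomorph_of_isOpenMap {f : X → Y} (hf : Continuous f) (hfo : IsOpenMap f)
    (hfi : IsLocallyInjective f) : IsLocalHomeomorph f := by
  refine isLocalHomeomorph_iff_isOpenEmbedding_restrict.2 fun x => ?_
  obtain ⟨U, hU, hxU, hfU⟩ := hfi x
  exact ⟨U, hU.mem_nhds hxU, .of_continuous_injective_isOpenMap
    hf.continuousOn.domRestrict hfU.injective (hfo.domRestrict hU)⟩

theorem isOpenMap_fst_fibredProduct {s : X → Z} (hs : Continuous s) {t : Y → Z}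
    (ht : IsOpenMap t) : IsOpenMap fun q : {q : X × Y // s q.1 = t q.2} => q.1.1 := by
  refine IsOpenMap.of_nhds_le fun ⟨(x, y), hxy⟩ S hS => ?_
  obtain ⟨W, hW, hWS⟩ := mem_nhds_subtype _ _ _ |>.1 hS
  obtain ⟨U, hU, V, hV, hUV⟩ := mem_nhds_prod_iff.1 hW
  have htV : t '' V ∈ 𝓝 (s x) := hxy ▸ ht.image_mem_nhds hV
  filter_upwards [hU, hs.continuousAt.preimage_mem_nhds htV] with x' hx' ⟨y', hy', hxy'⟩
  exact @hWS ⟨(x', y'), hxy'.symm⟩ (hUV ⟨hx', hy'⟩)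

theorem isLocalHomeomorph_fst_fibredProduct {s : X → Z} (hs : Continuous s) {t : Y → Z}
    (ht : IsLocalHomeomorph t) :
    IsLocalHomeomorph fun q : {q : X × Y // s q.1 = t q.2} => q.1.1 := by
  refine isLocalHomeomorph_of_isOpenMap (continuous_fst.comp continuous_subtype_val)
    (isOpenMap_fst_fibredProduct hs ht.isOpenMap) fun q => ?_
  obtain ⟨V, hV, hqV, htV⟩ := ht.isLocallyInjective q.1.2
  refine ⟨_, hV.preimage (continuous_snd.comp continuous_subtype_val), hqV, ?_⟩
  intro q₁ h₁ q₂ h₂ h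
  exact Subtype.ext (Prod.ext h (htV h₁ h₂ (q₁.2.symm.trans ((congrArg s h).trans q₂.2))))

end LocalHomeomorphisms

section LocalDiffeomorphisms

variable {𝕜 : Type*} [NontriviallyNormedField 𝕜]
  {E : Type*} [NormedAddCommGroup E] [NormedSpace 𝕜 E]
  {F : Type*} [NormedAddCommGroup F] [NormedSpace 𝕜 F]
  {K : Type*} [NormedAddCommGroup K] [NormedSpace 𝕜 K]
  {H₁ : Type*} [TopologicalSpace H₁] {I : ModelWithCorners 𝕜 E H₁}
  {H₂ : Type*} [TopologicalSpace H₂] {J : ModelWithCorners 𝕜 F H₂}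
  {H₃ : Type*} [TopologicalSpace H₃] {L : ModelWithCorners 𝕜 K H₃}
  {X : Type*} [TopologicalSpace X] [ChartedSpace H₁ X]
  {Y : Type*} [TopologicalSpace Y] [ChartedSpace H₂ Y]
  {Z : Type*} [TopologicalSpace Z] [ChartedSpace H₃ Z] {n : WithTop ℕ∞}

theorem isLocalDiffeomorphAt_congr {f g : X → Y} {x : X} (hf : IsLocalDiffeomorphAt I J n f x)
    (h : g =ᶠ[𝓝 x] f) : IsLocalDiffeomorphAt I J n g x := by
  obtain ⟨Φ, hx, hΦ⟩ := hf
  obtain ⟨U, hU, hUo, hxU⟩ := eventually_nhds_iff.1 h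
  let Ψ : PartialDiffeomorph I J X Y n :=
    { Φ.toOpenPartialHomeomorph.restrOpen U hUo with
      contMDiffOn_toFun := Φ.contMDiffOn_toFun.mono Set.inter_subset_left
      contMDiffOn_invFun := Φ.contMDiffOn_invFun.mono Set.inter_subset_left }
  exact ⟨Ψ, ⟨hx, hxU⟩, fun y hy => (hU y hy.2).trans (hΦ hy.1)⟩

theorem isLocalDiffeomorph_id : IsLocalDiffeomorph I I n fun x : X => x :=
  (Diffeomorph.refl I X n).isLocalDiffeomorph

theorem isLocalDiffeomorph_comp {g : Y → Z} (hg : IsLocalDiffeomorph J L n g) {f : X → Y}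
    (hf : IsLocalDiffeomorph I J n f) : IsLocalDiffeomorph I L n fun x => g (f x) :=
  fun x => (hf x).comp L _ (hg (f x))

theorem isLocalDiffeomorph_of_comp {p : Y → Z} (hp : IsLocalDiffeomorph J L n p) {f : X → Y}
    (hf : Continuous f) (hpf : IsLocalDiffeomorph I L n fun x => p (f x)) :
    IsLocalDiffeomorph I J n f := by
  intro x
  have h := (hpf x).comp J _ (hp (f x)).localInverse_isLocalDiffeomorphAt
  refine isLocalDiffeomorphAt_congr h ?_
  filter_upwards [hf.continuousAt.eventually (hp (f x)).localInverse_eventuallyEq_left] with y hy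
  exact hy.symm

theorem isLocalDiffeomorphAt_chartAt [IsManifold I n X] (x : X) :
    IsLocalDiffeomorphAt I I n (chartAt H₁ x) x :=
  ⟨{ chartAt H₁ x with
     contMDiffOn_toFun := contMDiffOn_chart
     contMDiffOn_invFun := contMDiffOn_chart_symm }, mem_chart_source H₁ x, fun _ _ => rfl⟩

theorem isLocalDiffeomorphAt_chartAt_symm [IsManifold I n X] (x : X) :
    IsLocalDiffeomorphAt I I n (chartAt H₁ x).symm (chartAt H₁ x x) :=
  ⟨{ (chartAt H₁ x).symm with
     contMDiffOn_toFun := contMDiffOn_chart_symm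
     contMDiffOn_invFun := contMDiffOn_chart }, mem_chart_target H₁ x, fun _ _ => rfl⟩

end LocalDiffeomorphisms

section Pullback

variable {H : Type*} [TopologicalSpace H] {X : Type*} [TopologicalSpace X]
  {Y : Type*} [TopologicalSpace Y] [ChartedSpace H Y] {p : X → Y} (hp : IsLocalHomeomorph p)

/-- The chart at `x` of the manifold structure pulled back along a local homeomorphism `p`: the
chart of the base at `p x`, composed with a local restriction of `p`. -/
def pullbackChart (x : X) : OpenPartialHomeomorph X H :=
  (hp.localInverseAt x).symm.trans (chartAt H (p x))

theorem pullbackChart_apply (x y : X) : pullbackChart (H := H) hp x y = chartAt H (p x) (p y) := by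
  simp [pullbackChart]

theorem apply_mem_chartAt_source {x y : X} (hy : y ∈ (pullbackChart (H := H) hp x).source) :
    p y ∈ (chartAt H (p x)).source := by
  simpa using hy.2

theorem mem_chartAt_target {x : X} {v : H} (hv : v ∈ (pullbackChart (H := H) hp x).target) :
    v ∈ (chartAt H (p x)).target :=
  hv.1

theorem apply_pullbackChart_symm {x : X} {v : H}
    (hv : v ∈ (pullbackChart (H := H) hp x).target) :
    p ((pullbackChart (H := H) hp x).symm v) = (chartAt H (p x)).symm v :=
  hp.apply_localInverseAt_of_mem hv.2

/-- The manifold structure pulled back along a local homeomorphism. -/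
@[reducible]
def pullbackChartedSpace : ChartedSpace H X where
  atlas := Set.range (pullbackChart hp)
  chartAt := pullbackChart hp
  mem_chart_source x := by simp [pullbackChart]
  chart_mem_atlas x := ⟨x, rfl⟩

theorem hasGroupoid_pullback (G : StructureGroupoid H) [ClosedUnderRestriction G]
    [HasGroupoid Y G] : @HasGroupoid H _ X _ (pullbackChartedSpace hp) G := by
  let : ChartedSpace H X := pullbackChartedSpace hp
  refine ⟨?_⟩
  rintro _ _ ⟨x, rfl⟩ ⟨y, rfl⟩
  set c := (chartAt H (p x)).symm ≫ₕ chartAt H (p y) with hc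
  set T := (pullbackChart (H := H) hp x).symm ≫ₕ pullbackChart (H := H) hp y with hT
  have hp_symm {v : H} (hv : v ∈ T.source) :
      p ((pullbackChart (H := H) hp x).symm v) = (chartAt H (p x)).symm v :=
    apply_pullbackChart_symm hp hv.1
  have hcT : Set.EqOn c T T.source := fun v hv => by
    rw [hT, hc, OpenPartialHomeomorph.coe_trans, OpenPartialHomeomorph.coe_trans,
      Function.comp_apply, Function.comp_apply, pullbackChart_apply, hp_symm hv]
  have hTc : T.source ⊆ c.source := fun v hv => by
    refine ⟨mem_chartAt_target hp hv.1, ?_⟩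
    change (chartAt H (p x)).symm v ∈ (chartAt H (p y)).source
    exact hp_symm hv ▸ apply_mem_chartAt_source hp hv.2
  have hc_mem : c ∈ G := HasGroupoid.compatible (chart_mem_atlas H (p x)) (chart_mem_atlas H (p y))
  have hT_mem := G.restr_mem_of_eqOn hc_mem T.open_source hcT (Set.inter_subset_left.trans hTc)
  rwa [T.restr_eq_of_source_subset subset_rfl] at hT_mem

variable {𝕜 : Type*} [NontriviallyNormedField 𝕜] {E : Type*} [NormedAddCommGroup E]
  [NormedSpace 𝕜 E] (I : ModelWithCorners 𝕜 E H) (n : WithTop ℕ∞) [IsManifold I n Y]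

theorem isManifold_pullback :
    letI := pullbackChartedSpace (H := H) hp
    IsManifold I n X :=
  letI := pullbackChartedSpace (H := H) hp
  have := hasGroupoid_pullback hp (contDiffGroupoid n I)
  IsManifold.mk' I n X

theorem isLocalDiffeomorph_pullback :
    letI := pullbackChartedSpace (H := H) hp
    IsLocalDiffeomorph I I n p := by
  let := pullbackChartedSpace (H := H) hp
  have := isManifold_pullback hp I n
  intro x
  have hx : chartAt H x x = chartAt H (p x) (p x) := pullbackChart_apply hp x x
  have h := (isLocalDiffeomorphAt_chartAt (I := I) (n := n) x).comp I _
    (hx ▸ isLocalDiffeomorphAt_chartAt_symm (I := I) (n := n) (p x))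
  refine isLocalDiffeomorphAt_congr h ?_
  filter_upwards [(chartAt H x).open_source.mem_nhds (mem_chart_source H x)] with y hy
  rw [Function.comp_apply, show chartAt H x y = _ from pullbackChart_apply hp x y,
    (chartAt H (p x)).left_inv (apply_mem_chartAt_source hp hy)]

end Pullback

namespace SmoothCc

variable {𝕜 : Type*} [RCLike 𝕜] {E : Type*} [NormedAddCommGroup E] [NormedSpace ℝ E]
  {M : Type*} [TopologicalSpace M] [ChartedSpace E M]

theorem mul_val (f g : SmoothCc 𝕜 E M) (x : M) : (f * g).1 x = f.1 x * g.1 x := rfl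

theorem continuous_val (f : SmoothCc 𝕜 E M) : Continuous f.1 := f.2.1.continuous

theorem mem_of_mem_supportedIn {f : SmoothCc 𝕜 E M} {W : Opens M} {x : M}
    (hf : f ∈ supportedIn W) (hx : f.1 x ≠ 0) : x ∈ W :=
  hf (subset_tsupport _ hx)

theorem GermOne.eq_one {f : SmoothCc 𝕜 E M} {x : M} (h : GermOne f x) : f.1 x = 1 :=
  h.self_of_nhds

theorem GermOne.mul {f g : SmoothCc 𝕜 E M} {x : M} (hf : GermOne f x) (hg : GermOne g x) :
    GermOne (f * g) x := by
  filter_upwards [hf, hg] with y hfy hgy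
  rw [mul_val, hfy, hgy, one_mul]

variable [FiniteDimensional ℝ E] [T2Space M] [IsManifold 𝓘(ℝ, E) ∞ M]

section Bump

variable (𝕜 E)

theorem exists_germOne_at (x : M) : ∃ f : SmoothCc 𝕜 E M, GermOne f x :=
  let ⟨f, hf, _⟩ := exists_germOne (𝕜 := 𝕜) (E := E) (x := x) univ_mem
  ⟨f, hf⟩

theorem exists_germOne_supportedIn {x : M} {W : Opens M} (hx : x ∈ W) :
    ∃ f : SmoothCc 𝕜 E M, GermOne f x ∧ f ∈ supportedIn W := by
  have : LocallyCompactSpace M := Manifold.locallyCompact_of_finiteDimensional 𝓘(ℝ, E)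
  obtain ⟨t, ht, htc, htW⟩ := exists_mem_nhds_isClosed_subset (W.isOpen.mem_nhds hx)
  obtain ⟨f, hf, hft⟩ := exists_germOne (𝕜 := 𝕜) (E := E) ht
  exact ⟨f, hf, (closure_minimal hft htc).trans htW⟩

theorem eq_of_forall_mem_supportedIn {x y : M} {W : Opens M} (hx : x ∈ W)
    (h : ∀ f ∈ supportedIn (𝕜 := 𝕜) (E := E) W, f.1 x = f.1 y) : x = y := by
  by_contra hxy
  have hx' : x ∈ W ⊓ ⟨{y}ᶜ, isOpen_compl_singleton⟩ := ⟨hx, hxy⟩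
  obtain ⟨f, hf, hfs⟩ := exists_germOne_supportedIn 𝕜 E hx'
  have hy : f.1 y = 1 := (h f fun z hz => (hfs hz).1).symm.trans hf.eq_one
  exact (mem_of_mem_supportedIn hfs (hy ▸ one_ne_zero)).2 rfl

theorem le_of_supportedIn_subset {V W : Opens M}
    (h : supportedIn (𝕜 := 𝕜) (E := E) V ⊆ supportedIn W) : V ≤ W := by
  intro x hx
  obtain ⟨f, hf, hfV⟩ := exists_germOne_supportedIn 𝕜 E hx
  exact mem_of_mem_supportedIn (h hfV) (by rw [hf.eq_one]; exact one_ne_zero)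

theorem supportedIn_injective :
    Function.Injective (supportedIn (𝕜 := 𝕜) (E := E) (M := M)) := fun _ _ h =>
  le_antisymm (le_of_supportedIn_subset 𝕜 E h.subset) (le_of_supportedIn_subset 𝕜 E h.superset)

end Bump

theorem exists_eventuallyEq {x : M} {U : Set M} (hU : U ∈ 𝓝 x) {g : M → 𝕜}
    (hg : ∀ y ∈ U, ContMDiffAt 𝓘(ℝ, E) 𝓘(ℝ, 𝕜) ∞ g y) :
    ∃ f : SmoothCc 𝕜 E M, f.1 =ᶠ[𝓝 x] g := by
  obtain ⟨V, hVU, hV, hxV⟩ := mem_nhds_iff.1 hU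
  obtain ⟨q, hq, hqV⟩ := exists_germOne_supportedIn 𝕜 E (W := ⟨V, hV⟩) hxV
  refine ⟨⟨fun y => q.1 y * g y, contMDiff_of_tsupport fun y hy => ?_, q.2.2.mul_right⟩, ?_⟩
  · have hgy := hg y (hVU (hqV (tsupport_mul_subset_left hy)))
    exact (contDiff_mul (𝕜 := ℝ) (𝔸 := 𝕜)).contMDiff.contMDiffAt.comp y
      (q.2.1.contMDiffAt.prodMk_space hgy)
  · filter_upwards [hq] with y hy
    rw [hy, one_mul]

theorem exists_germOne_mul (f : SmoothCc 𝕜 E M) {x : M} (hx : f.1 x ≠ 0) :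
    ∃ g : SmoothCc 𝕜 E M, GermOne (f * g) x := by
  have hU : {y | f.1 y ≠ 0} ∈ 𝓝 x := (continuous_val f).continuousAt.eventually_ne hx
  obtain ⟨g, hg⟩ := exists_eventuallyEq (𝕜 := 𝕜) (E := E) hU (g := fun y => (f.1 y)⁻¹)
    fun y hy => (contDiffAt_inv ℝ (𝕜' := 𝕜) hy).contMDiffAt.comp y f.2.1.contMDiffAt
  refine ⟨g, ?_⟩
  filter_upwards [hg, hU] with y hy hy'
  rw [mul_val, hy, mul_inv_cancel₀ hy']

section Character

variable (χ : SmoothCc 𝕜 E M →ₙₐ[𝕜] 𝕜)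

theorem exists_map_eq_zero_eqOn_one {K : Set M} (hK : IsCompact K)
    (h : ∀ y ∈ K, ∃ f, χ f = 0 ∧ f.1 y ≠ 0) : ∃ e, χ e = 0 ∧ ∀ y ∈ K, e.1 y = 1 := by
  refine hK.induction_on (p := fun s => ∃ e, χ e = 0 ∧ ∀ y ∈ s, e.1 y = 1)
    ⟨0, map_zero χ, by simp⟩ ?mono ?union ?nhds
  case mono =>
    rintro s t hst ⟨e, he, he_one⟩
    exact ⟨e, he, fun y hy => he_one y (hst hy)⟩
  case union =>
    -- `1 - (e + e' - e e') = (1 - e) (1 - e')` vanishes where `1 - e` or `1 - e'` does.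
    rintro s t ⟨e, he, he_one⟩ ⟨e', he', he'_one⟩
    refine ⟨e + e' - e * e', by simp [he, he'], fun y hy => ?_⟩
    change e.1 y + e'.1 y - e.1 y * e'.1 y = 1
    rcases hy with hy | hy
    · rw [he_one y hy]; ring
    · rw [he'_one y hy]; ring
  case nhds =>
    intro y hy
    obtain ⟨f, hf, hfy⟩ := h y hy
    obtain ⟨g, hg⟩ := exists_germOne_mul f hfy
    exact ⟨_, mem_nhdsWithin_of_mem_nhds hg, f * g, by simp [hf], fun _ hz => hz⟩

variable {χ}

theorem exists_forall_map_eq_zero (hχ : χ ≠ 0) : ∃ x, ∀ f, χ f = 0 → f.1 x = 0 := by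
  by_contra! h
  refine hχ (NonUnitalAlgHom.ext fun f => ?_)
  obtain ⟨e, he, he_one⟩ := exists_map_eq_zero_eqOn_one χ f.2.2 fun y _ => h y
  have hf : f = f * e := by
    ext y
    by_cases hy : y ∈ tsupport f.1
    · rw [mul_val, he_one y hy, mul_one]
    · rw [mul_val, image_eq_zero_of_notMem_tsupport hy, zero_mul]
  rw [hf, map_mul, he, mul_zero, NonUnitalAlgHom.zero_apply]

theorem exists_forall_eq_eval (hχ : χ ≠ 0) : ∃ x, ∀ f, χ f = f.1 x := by
  obtain ⟨x, hx⟩ := exists_forall_map_eq_zero hχ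
  obtain ⟨h, hh⟩ : ∃ h, χ h = 1 := by
    obtain ⟨h, hh⟩ := DFunLike.ne_iff.1 hχ
    exact ⟨(χ h)⁻¹ • h, by rw [map_smul, smul_eq_mul, inv_mul_cancel₀ hh]⟩
  have eval_eq (f : SmoothCc 𝕜 E M) : f.1 x = χ f * h.1 x :=
    sub_eq_zero.1 (hx (f - χ f • h) (by simp [hh]))
  obtain ⟨e, he⟩ := exists_germOne_at 𝕜 E x
  have hx_ne : h.1 x ≠ 0 := right_ne_zero_of_mul (eval_eq e ▸ he.eq_one ▸ one_ne_zero)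
  have hx_one : h.1 x = 1 := by
    have hx_sq := eval_eq (h * h)
    rw [mul_val, map_mul, hh, one_mul] at hx_sq
    exact mul_right_cancel₀ hx_ne hx_sq
  exact ⟨x, fun f => by rw [eval_eq, hx_one, mul_one]⟩

end Character

section Smoothness

variable {N : Type*} [TopologicalSpace N] {φ : N → M} {x : N}

variable (𝕜 E) in
theorem continuousAt_of_forall_comp
    (h : ∀ f : SmoothCc 𝕜 E M, ContinuousAt (fun y => f.1 (φ y)) x) : ContinuousAt φ x := by
  intro U hU
  obtain ⟨f, hf, hfU⟩ := exists_germOne (𝕜 := 𝕜) (E := E) hU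
  have hne : ∀ᶠ y in 𝓝 x, f.1 (φ y) ≠ 0 :=
    (h f).eventually_ne (by rw [hf.eq_one]; exact one_ne_zero)
  exact hne.mono fun y hy => hfU _ hy

variable (𝕜) in
theorem exists_eventuallyEq_clm_extChartAt (z : M) (l : E →L[ℝ] ℝ) :
    ∃ f : SmoothCc 𝕜 E M, ∀ᶠ y in 𝓝 z, f.1 y = (l (extChartAt 𝓘(ℝ, E) z y) : 𝕜) := by
  have hl : ContDiff ℝ ∞ fun v => (l v : 𝕜) := (RCLike.ofRealCLM (K := 𝕜)).contDiff.comp l.contDiff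
  exact exists_eventuallyEq (extChartAt_source_mem_nhds (I := 𝓘(ℝ, E)) z) fun y hy =>
    hl.contMDiff.contMDiffAt.comp y (contMDiffAt_extChartAt' (by simpa using hy))

variable {F : Type*} [NormedAddCommGroup F] [NormedSpace ℝ F] {H : Type*} [TopologicalSpace H]
  {I : ModelWithCorners ℝ F H} [ChartedSpace H N]

theorem contMDiffAt_of_forall_comp
    (h : ∀ f : SmoothCc 𝕜 E M, ContMDiffAt I 𝓘(ℝ, 𝕜) ∞ (fun y => f.1 (φ y)) x) :
    ContMDiffAt I 𝓘(ℝ, E) ∞ φ x := by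
  have hφ : ContinuousAt φ x := continuousAt_of_forall_comp 𝕜 E fun f => (h f).continuousAt
  refine contMDiffAt_iff_target.2 ⟨hφ, ?_⟩
  let L := (Module.finBasis ℝ E).equivFunL
  suffices hL : ContMDiffAt I 𝓘(ℝ, Fin (Module.finrank ℝ E) → ℝ) ∞
      (fun y => L (extChartAt 𝓘(ℝ, E) (φ x) (φ y))) x by
    refine ((L.symm.contDiff (n := ∞)).contMDiff.contMDiffAt.comp x hL).congr_of_eventuallyEq
      (Eventually.of_forall fun y => ?_)
    simp only [Function.comp_apply, ContinuousLinearEquiv.symm_apply_apply]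
  refine contMDiffAt_pi_space.2 fun i => ?_
  obtain ⟨f, hf⟩ := exists_eventuallyEq_clm_extChartAt 𝕜 (φ x)
    ((ContinuousLinearMap.proj i).comp (L : E →L[ℝ] Fin _ → ℝ))
  have hre := (RCLike.reCLM (K := 𝕜)).contDiff (n := ∞) |>.contMDiff.contMDiffAt.comp x (h f)
  refine hre.congr_of_eventuallyEq ?_
  filter_upwards [hφ.eventually hf] with y hy
  simp [hy]

end Smoothness

end SmoothCc

namespace HopfAlgebroid

open SmoothCc

section Links

variable {𝕜 : Type*} [RCLike 𝕜] {E : Type*} [NormedAddCommGroup E] [NormedSpace ℝ E]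
  {M : Type u} [TopologicalSpace M] [ChartedSpace E M]
  {A : HopfAlgebroid.{v} 𝕜 (SmoothCc 𝕜 E M)} {a b : A.carrier} {x y z : M}

/-- The element `a` links `x` to `y` if `ε a` is `1` at `y` and `ε (a g) (y) = g x` for all `g`:
when `a` is weakly grouplike, its class at `y` should be an arrow from `x` to `y`. The function
`ε (a g)` is written as `T_{S a} g`. -/
structure Links (A : HopfAlgebroid.{v} 𝕜 (SmoothCc 𝕜 E M)) (a : A.carrier) (x y : M) : Prop where
  counit_eq : (A.counit a).1 y = 1
  T_antipode_eq : ∀ g, (A.T (A.antipode a) g).1 y = g.1 x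

theorem links_ι {f : SmoothCc 𝕜 E M} (hf : f.1 x = 1) : A.Links (A.ι f) x x where
  counit_eq := by rw [A.counit_ι, hf]
  T_antipode_eq g := by rw [A.antipode_ι, T_ι, mul_val, hf, mul_one]

theorem Links.T_eq (h : A.Links a x y) (ha : a ∈ A.invariantWeaklyGrouplike)
    (f : SmoothCc 𝕜 E M) : (A.T a f).1 x = f.1 y := by
  rw [← h.T_antipode_eq, T_antipode_T ha, mul_val, mul_val, h.counit_eq, one_mul, mul_one]

theorem Links.mul (h : A.Links b y z) (h' : A.Links a x y)
    (hb : b ∈ A.invariantWeaklyGrouplike) (ha : a ∈ A.invariantWeaklyGrouplike) :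
    A.Links (b * a) x z where
  counit_eq := by rw [counit_mul hb ha, h.T_antipode_eq, h'.counit_eq]
  T_antipode_eq g := by
    rw [A.antipode_mul, T_mul (antipode_mem_invariantWeaklyGrouplike ha)
      (antipode_mem_invariantWeaklyGrouplike hb), h.T_antipode_eq, h'.T_antipode_eq]

theorem Links.map {B : HopfAlgebroid.{v} 𝕜 (SmoothCc 𝕜 E M)} (h : A.Links a x y) (α : A ⟶ B) :
    B.Links (Hom.toAlgHom α a) x y where
  counit_eq := by rw [Hom.counit_map, h.counit_eq]
  T_antipode_eq g := by
    rw [T_antipode_apply, ← Hom.map_ι α, ← map_mul, Hom.counit_map, ← T_antipode_apply,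
      h.T_antipode_eq]

/-- The character `g ↦ ε (a g) (y)` of the algebra of functions, for an `S`-invariant weakly
grouplike element `a` with `ε a = 1` at `y`. -/
def evalCharacter (ha : a ∈ A.invariantWeaklyGrouplike) (hy : (A.counit a).1 y = 1) :
    SmoothCc 𝕜 E M →ₙₐ[𝕜] 𝕜 where
  toFun g := (A.T (A.antipode a) g).1 y
  map_smul' c g := by rw [map_smul]; rfl
  map_zero' := by rw [map_zero]; rfl
  map_add' f g := by rw [map_add]; rfl
  map_mul' f g := by
    have hSa := antipode_mem_invariantWeaklyGrouplike ha
    calc (A.T (A.antipode a) (f * g)).1 y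
        = (A.T (A.antipode a) (f * g) * A.counit (A.antipode (A.antipode a))).1 y := by
          rw [A.antipode_antipode, mul_val, hy, mul_one]
      _ = (A.T (A.antipode a) (f * A.counit (A.antipode a) * g)).1 y := by
          rw [T_mul_counit_antipode hSa, mul_right_comm]
      _ = (A.T (A.antipode a) f).1 y * (A.T (A.antipode a) g).1 y := by
          rw [← T_mul_T hSa, mul_val]

theorem evalCharacter_apply (ha : a ∈ A.invariantWeaklyGrouplike) (hy : (A.counit a).1 y = 1)
    (g : SmoothCc 𝕜 E M) : evalCharacter ha hy g = (A.T (A.antipode a) g).1 y := rfl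

variable (A) in
/-- The open set of points at which some `T_a f`, with `f` supported in `W`, does not vanish; for
`a` normalized on `W` it consists of the sources of the arrows `a_y`, `y ∈ W`. -/
def sourceOpens (a : A.carrier) (W : Opens M) : Opens M where
  carrier := ⋃ f ∈ supportedIn (𝕜 := 𝕜) (E := E) W, {x | (A.T a f).1 x ≠ 0}
  is_open' := isOpen_biUnion fun _ _ => isOpen_ne_fun (continuous_val _) continuous_const

theorem mem_sourceOpens {W : Opens M} :
    x ∈ A.sourceOpens a W ↔ ∃ f ∈ supportedIn (𝕜 := 𝕜) (E := E) W, (A.T a f).1 x ≠ 0 :=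
  Set.mem_iUnion₂.trans (by simp only [Set.mem_ofPred_eq, exists_prop])

open Classical in
variable (A) in
/-- The source of the arrow represented by `a` with target `y`; if there is no such arrow, the
value is `y`. -/
def sourceMap (a : A.carrier) (y : M) : M := if h : ∃ x, A.Links a x y then h.choose else y

theorem NormalizedAt.eventually (h : A.NormalizedAt a x) : ∀ᶠ y in 𝓝 x, A.NormalizedAt a y :=
  eventually_eventually_nhds.2 h

variable (A) in
/-- The largest open set on which `a` is normalized. -/
def normalizedOpens (a : A.carrier) : Opens M :=
  ⟨{y | A.NormalizedAt a y}, isOpen_iff_mem_nhds.2 fun _ h => NormalizedAt.eventually h⟩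

theorem normalizedOn_normalizedOpens (a : A.carrier) : A.NormalizedOn a (A.normalizedOpens a) :=
  fun _ h => h

theorem NormalizedOn.mul_counit {W : Opens M} (h : A.NormalizedOn a W) {f : SmoothCc 𝕜 E M}
    (hf : f ∈ supportedIn W) : f * A.counit a = f := by
  ext y
  rw [mul_val]
  by_cases hy : f.1 y = 0
  · rw [hy, zero_mul]
  · rw [(h y (mem_of_mem_supportedIn hf hy)).eq_one, mul_one]

theorem counit_antipode_eq_one (ha : a ∈ A.invariantWeaklyGrouplike) {W : Opens M}
    (hW : A.NormalizedOn a W) (hx : x ∈ A.sourceOpens a W) :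
    (A.counit (A.antipode a)).1 x = 1 := by
  obtain ⟨f, hf, hx⟩ := mem_sourceOpens.1 hx
  refine mul_left_cancel₀ hx ?_
  rw [← mul_val, T_mul_counit_antipode ha, hW.mul_counit hf, mul_one]

theorem normalizedOn_sourceOpens (ha : a ∈ A.invariantWeaklyGrouplike) {W : Opens M}
    (hW : A.NormalizedOn a W) : A.NormalizedOn (A.antipode a) (A.sourceOpens a W) := by
  intro x hx
  filter_upwards [(A.sourceOpens a W).isOpen.mem_nhds hx] with z hz
  exact counit_antipode_eq_one ha hW hz

theorem normalizedAt_ι {f : SmoothCc 𝕜 E M} (hf : GermOne f y) : A.NormalizedAt (A.ι f) y := by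
  rwa [NormalizedAt, A.counit_ι]

end Links

section Stalks

variable {𝕜 : Type*} [RCLike 𝕜] {E : Type*} [NormedAddCommGroup E] [NormedSpace ℝ E]
  [FiniteDimensional ℝ E] {M : Type u} [TopologicalSpace M] [T2Space M] [ChartedSpace E M]
  [IsManifold 𝓘(ℝ, E) ∞ M]
  {A : HopfAlgebroid.{v} 𝕜 (SmoothCc 𝕜 E M)} {a b c : A.carrier} {x y z : M}

theorem germ_eq_iff : A.germ x a = A.germ x b ↔
    ∃ q : SmoothCc 𝕜 E M, GermOne q x ∧ A.ι q * a = A.ι q * b := by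
  rw [← sub_eq_zero, ← map_sub, germ, Submodule.mkQ_apply, Submodule.Quotient.mk_eq_zero]
  refine exists_congr fun q => and_congr_right fun _ => ?_
  rw [mul_sub, sub_eq_zero]

theorem germ_ι_mul {f : SmoothCc 𝕜 E M} (hf : GermOne f x) (a : A.carrier) :
    A.germ x (A.ι f * a) = A.germ x a :=
  A.stalkAct_of_germOne hf (A.germ x a)

theorem germ_mul_congr_left (h : A.germ x a = A.germ x b) (c : A.carrier) :
    A.germ x (a * c) = A.germ x (b * c) := by
  obtain ⟨q, hq, h⟩ := germ_eq_iff.1 h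
  exact germ_eq_iff.2 ⟨q, hq, by rw [← mul_assoc, h, mul_assoc]⟩

theorem germ_ι_eq {f g : SmoothCc 𝕜 E M} (hf : GermOne f x) (hg : GermOne g x) :
    A.germ x (A.ι f) = A.germ x (A.ι g) := by
  rw [← germ_ι_mul hg, ← map_mul, mul_comm, map_mul, germ_ι_mul hf]

theorem eventually_germ_eq (h : A.germ x a = A.germ x b) :
    ∀ᶠ y in 𝓝 x, A.germ y a = A.germ y b := by
  obtain ⟨q, hq, h⟩ := germ_eq_iff.1 h
  filter_upwards [eventually_eventually_nhds.2 hq] with y hy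
  exact germ_eq_iff.2 ⟨q, hy, h⟩

theorem eventually_counit_eq (h : A.germ x a = A.germ x b) :
    ∀ᶠ y in 𝓝 x, (A.counit a).1 y = (A.counit b).1 y := by
  obtain ⟨q, hq, h⟩ := germ_eq_iff.1 h
  have hε : q * A.counit a = q * A.counit b := by rw [← A.counit_left, h, A.counit_left]
  filter_upwards [hq] with y hy
  have hεy : q.1 y * (A.counit a).1 y = q.1 y * (A.counit b).1 y := by
    rw [← mul_val, hε, mul_val]
  rwa [hy, one_mul, one_mul] at hεy

theorem NormalizedAt.congr (ha : A.NormalizedAt a x) (h : A.germ x a = A.germ x b) :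
    A.NormalizedAt b x := by
  filter_upwards [eventually_counit_eq h, ha] with y hy hay
  exact hy ▸ hay

theorem Links.antipode (h : A.Links a x y) (ha : a ∈ A.invariantWeaklyGrouplike) :
    A.Links (A.antipode a) y x where
  counit_eq := by
    obtain ⟨f, hf⟩ := exists_germOne_at 𝕜 E y
    calc (A.counit (A.antipode a)).1 x
        = (A.T a f * A.counit (A.antipode a)).1 x := by
          rw [mul_val, h.T_eq ha, hf.eq_one, one_mul]
      _ = 1 := by
          rw [T_mul_counit_antipode ha, h.T_eq ha, mul_val, hf.eq_one, h.counit_eq, one_mul]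
  T_antipode_eq g := by rw [A.antipode_antipode, h.T_eq ha]

theorem links_antipode_iff (ha : a ∈ A.invariantWeaklyGrouplike) :
    A.Links (A.antipode a) y x ↔ A.Links a x y where
  mp h := by
    simpa only [A.antipode_antipode] using h.antipode (antipode_mem_invariantWeaklyGrouplike ha)
  mpr h := h.antipode ha

theorem Links.source_unique (h : A.Links a x y) (h' : A.Links a z y) : x = z :=
  eq_of_forall_mem_supportedIn 𝕜 E (Opens.mem_top x) fun f _ => by
    rw [← h.T_antipode_eq, h'.T_antipode_eq]

theorem Links.target_unique (h : A.Links a x y) (h' : A.Links a x z)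
    (ha : a ∈ A.invariantWeaklyGrouplike) : y = z :=
  (h.antipode ha).source_unique (h'.antipode ha)

theorem evalCharacter_ne_zero (ha : a ∈ A.invariantWeaklyGrouplike)
    (hy : (A.counit a).1 y = 1) : evalCharacter ha hy ≠ 0 := by
  obtain ⟨f, hf⟩ := exists_germOne_at 𝕜 E y
  refine DFunLike.ne_iff.2 ⟨A.T a f, ?_⟩
  rw [evalCharacter_apply, T_antipode_T ha, mul_val, mul_val, hy, hf.eq_one, one_mul, one_mul,
    NonUnitalAlgHom.zero_apply]
  exact one_ne_zero

theorem exists_links (ha : a ∈ A.invariantWeaklyGrouplike) (hy : (A.counit a).1 y = 1) :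
    ∃ x, A.Links a x y :=
  let ⟨x, hx⟩ := exists_forall_eq_eval (evalCharacter_ne_zero ha hy)
  ⟨x, hy, hx⟩

theorem Links.congr (h : A.Links a x y) (hab : A.germ y a = A.germ y b) : A.Links b x y where
  counit_eq := (eventually_counit_eq hab).self_of_nhds.symm.trans h.counit_eq
  T_antipode_eq g := by
    rw [← h.T_antipode_eq, T_antipode_apply, T_antipode_apply,
      (eventually_counit_eq (germ_mul_congr_left hab _)).self_of_nhds]

theorem Links.sourceMap_eq (h : A.Links a x y) : A.sourceMap a y = x := by
  have hex : ∃ x, A.Links a x y := ⟨x, h⟩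
  rw [sourceMap, dif_pos hex]
  exact hex.choose_spec.source_unique h

theorem links_sourceMap (ha : a ∈ A.invariantWeaklyGrouplike) (hy : (A.counit a).1 y = 1) :
    A.Links a (A.sourceMap a y) y := by
  obtain ⟨x, hx⟩ := exists_links ha hy
  rwa [hx.sourceMap_eq]

theorem Links.germOne_T_antipode (h : A.Links a x y) (ha : a ∈ A.invariantWeaklyGrouplike)
    (hn : A.NormalizedAt a y) {q : SmoothCc 𝕜 E M} (hq : GermOne q x) :
    GermOne (A.T (A.antipode a) q) y := by
  obtain ⟨r, hr, hrq⟩ := exists_germOne (𝕜 := 𝕜) (E := E) hq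
  have hr_ne : ∀ᶠ z in 𝓝 y, (A.T (A.antipode a) r).1 z ≠ 0 :=
    (continuous_val _).continuousAt.eventually_ne (by
      rw [h.T_antipode_eq, hr.eq_one]; exact one_ne_zero)
  filter_upwards [hr_ne, hn] with z hrz hz
  obtain ⟨w, hw⟩ := exists_links ha hz
  rw [hw.T_antipode_eq] at hrz ⊢
  exact hrq w hrz

theorem Links.normalizedAt_mul (h : A.Links b y z) (hb : b ∈ A.invariantWeaklyGrouplike)
    (ha : a ∈ A.invariantWeaklyGrouplike) (hnb : A.NormalizedAt b z)
    (hna : A.NormalizedAt a y) : A.NormalizedAt (b * a) z := by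
  rw [NormalizedAt, counit_mul hb ha]
  exact h.germOne_T_antipode hb hnb hna

theorem mem_sourceOpens_iff_exists_links (ha : a ∈ A.invariantWeaklyGrouplike) {W : Opens M}
    (hW : A.NormalizedOn a W) : x ∈ A.sourceOpens a W ↔ ∃ y ∈ W, A.Links a x y := by
  constructor
  · intro hx
    obtain ⟨y, hy⟩ := exists_links (antipode_mem_invariantWeaklyGrouplike ha)
      (counit_antipode_eq_one ha hW hx)
    rw [links_antipode_iff ha] at hy
    obtain ⟨f, hf, hfx⟩ := mem_sourceOpens.1 hx
    rw [hy.T_eq ha] at hfx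
    exact ⟨y, mem_of_mem_supportedIn hf hfx, hy⟩
  · rintro ⟨y, hy, h⟩
    obtain ⟨f, hf, hfW⟩ := exists_germOne_supportedIn 𝕜 E hy
    exact mem_sourceOpens.2 ⟨f, hfW, by rw [h.T_eq ha, hf.eq_one]; exact one_ne_zero⟩

theorem Links.normalizedAt_antipode (h : A.Links a x y) (ha : a ∈ A.invariantWeaklyGrouplike)
    (hn : A.NormalizedAt a y) : A.NormalizedAt (A.antipode a) x :=
  have hW := normalizedOn_normalizedOpens a
  normalizedOn_sourceOpens ha hW x ((mem_sourceOpens_iff_exists_links ha hW).2 ⟨y, hn, h⟩)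

theorem Links.germ_mul_congr_right (h : A.Links b y z) (hb : b ∈ A.invariantWeaklyGrouplike)
    (hn : A.NormalizedAt b z) (hac : A.germ y a = A.germ y c) :
    A.germ z (b * a) = A.germ z (b * c) := by
  obtain ⟨q, hq, hac⟩ := germ_eq_iff.1 hac
  refine germ_eq_iff.2 ⟨_, h.germOne_T_antipode hb hn hq, ?_⟩
  rw [← mul_assoc, ι_T_antipode_mul hb, mul_assoc, hac, ← mul_assoc, ← ι_T_antipode_mul hb,
    mul_assoc]

theorem Links.germ_mul_ι (h : A.Links a x y) (ha : a ∈ A.invariantWeaklyGrouplike)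
    (hn : A.NormalizedAt a y) {q : SmoothCc 𝕜 E M} (hq : GermOne q x) :
    A.germ y (a * A.ι q) = A.germ y a := by
  rw [← germ_ι_mul hn, ← mul_assoc, ← ι_T_antipode_mul ha,
    germ_ι_mul (h.germOne_T_antipode ha hn hq)]

theorem Links.germ_antipode_ι_mul (h : A.Links a x y) (ha : a ∈ A.invariantWeaklyGrouplike)
    (hn : A.NormalizedAt a y) {q : SmoothCc 𝕜 E M} (hq : GermOne q y) :
    A.germ x (A.antipode (A.ι q * a)) = A.germ x (A.antipode a) := by
  rw [A.antipode_mul, A.antipode_ι]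
  exact (h.antipode ha).germ_mul_ι (antipode_mem_invariantWeaklyGrouplike ha)
    (h.normalizedAt_antipode ha hn) hq

theorem Links.germ_antipode_congr (h : A.Links a x y) (ha : a ∈ A.invariantWeaklyGrouplike)
    (hn : A.NormalizedAt a y) (hc : c ∈ A.invariantWeaklyGrouplike)
    (hac : A.germ y a = A.germ y c) :
    A.germ x (A.antipode a) = A.germ x (A.antipode c) := by
  have hnc := hn.congr hac
  have hlc := h.congr hac
  obtain ⟨q, hq, hac⟩ := germ_eq_iff.1 hac
  rw [← h.germ_antipode_ι_mul ha hn hq, hac, hlc.germ_antipode_ι_mul hc hnc hq]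

section InducedDiffeomorphism

variable {W V : Opens M}

theorem contMDiffOn_sourceMap (ha : a ∈ A.invariantWeaklyGrouplike)
    (hW : A.NormalizedOn a W) : ContMDiffOn 𝓘(ℝ, E) 𝓘(ℝ, E) ∞ (A.sourceMap a) W := by
  intro y hy
  refine (contMDiffAt_of_forall_comp (𝕜 := 𝕜) fun f => ?_).contMDiffWithinAt
  refine (A.T (A.antipode a) f).2.1.contMDiffAt.congr_of_eventuallyEq ?_
  filter_upwards [W.isOpen.mem_nhds hy] with z hz
  exact ((links_sourceMap ha (hW z hz).eq_one).T_antipode_eq f).symm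

/-- The partial diffeomorphism from the targets to the sources of the arrows `a_y`, `y ∈ W`. -/
def sourcePartialDiffeomorph (ha : a ∈ A.invariantWeaklyGrouplike) (hW : A.NormalizedOn a W) :
    PartialDiffeomorph 𝓘(ℝ, E) 𝓘(ℝ, E) M M ∞ where
  toFun := A.sourceMap a
  invFun := A.sourceMap (A.antipode a)
  source := W
  target := A.sourceOpens a W
  map_source' y hy :=
    (mem_sourceOpens_iff_exists_links ha hW).2 ⟨y, hy, links_sourceMap ha (hW y hy).eq_one⟩
  map_target' x hx := by
    obtain ⟨y, hy, h⟩ := (mem_sourceOpens_iff_exists_links ha hW).1 hx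
    rwa [(h.antipode ha).sourceMap_eq]
  left_inv' y hy := ((links_sourceMap ha (hW y hy).eq_one).antipode ha).sourceMap_eq
  right_inv' x hx := by
    obtain ⟨y, -, h⟩ := (mem_sourceOpens_iff_exists_links ha hW).1 hx
    rw [(h.antipode ha).sourceMap_eq, h.sourceMap_eq]
  open_source := W.isOpen
  open_target := (A.sourceOpens a W).isOpen
  contMDiffOn_toFun := contMDiffOn_sourceMap ha hW
  contMDiffOn_invFun := contMDiffOn_sourceMap (antipode_mem_invariantWeaklyGrouplike ha)
    (normalizedOn_sourceOpens ha hW)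

/-- The diffeomorphism `τ_{W, a}`, which maps the source of the arrow `a_y` to `y ∈ W`. -/
def targetDiffeomorph (ha : a ∈ A.invariantWeaklyGrouplike) (hW : A.NormalizedOn a W) :
    Diffeomorph 𝓘(ℝ, E) 𝓘(ℝ, E) (A.sourceOpens a W) W ∞ :=
  let s := sourcePartialDiffeomorph ha hW
  { toFun := fun x => ⟨A.sourceMap (A.antipode a) x, s.map_target' x.2⟩
    invFun := fun y => ⟨A.sourceMap a y, s.map_source' y.2⟩
    left_inv := fun x => Subtype.ext (s.right_inv' x.2)
    right_inv := fun y => Subtype.ext (s.left_inv' y.2)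
    contMDiff_toFun := (ContMDiff.subtypeVal_comp_iff _ _).1
      (s.contMDiffOn_invFun.comp_contMDiff contMDiff_subtype_val Subtype.prop)
    contMDiff_invFun := (ContMDiff.subtypeVal_comp_iff _ _).1
      (s.contMDiffOn_toFun.comp_contMDiff contMDiff_subtype_val Subtype.prop) }

theorem links_targetDiffeomorph (ha : a ∈ A.invariantWeaklyGrouplike)
    (hW : A.NormalizedOn a W) (x : A.sourceOpens a W) :
    A.Links a x (targetDiffeomorph ha hW x) := by
  obtain ⟨y, -, h⟩ := (mem_sourceOpens_iff_exists_links ha hW).1 x.2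
  have hxy : (targetDiffeomorph ha hW x : M) = y := (h.antipode ha).sourceMap_eq
  rwa [hxy]

theorem T_mem_supportedIn (ha : a ∈ A.invariantWeaklyGrouplike) (hW : A.NormalizedOn a W)
    {f : SmoothCc 𝕜 E M} (hf : f ∈ supportedIn W) :
    A.T a f ∈ supportedIn (A.sourceOpens a W) := by
  have hcompact : IsCompact (A.sourceMap a '' tsupport f.1) :=
    f.2.2.image_of_continuousOn ((contMDiffOn_sourceMap ha hW).continuousOn.mono hf)
  have hsub : tsupport (A.T a f).1 ⊆ A.sourceMap a '' tsupport f.1 := by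
    refine closure_minimal (fun x hx => ?_) hcompact.isClosed
    obtain ⟨y, -, h⟩ :=
      (mem_sourceOpens_iff_exists_links ha hW).1 (mem_sourceOpens.2 ⟨f, hf, hx⟩)
    refine ⟨y, subset_tsupport _ ?_, h.sourceMap_eq⟩
    rwa [Function.mem_support, ← h.T_eq ha]
  refine hsub.trans ?_
  rintro _ ⟨y, hy, rfl⟩
  exact (sourcePartialDiffeomorph ha hW).map_source' (hf hy)

theorem sourceOpens_antipode_sourceOpens (ha : a ∈ A.invariantWeaklyGrouplike)
    (hW : A.NormalizedOn a W) : A.sourceOpens (A.antipode a) (A.sourceOpens a W) = W := by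
  refine Opens.ext (Set.ext fun y => ?_)
  rw [SetLike.mem_coe, SetLike.mem_coe, mem_sourceOpens_iff_exists_links
    (antipode_mem_invariantWeaklyGrouplike ha) (normalizedOn_sourceOpens ha hW)]
  constructor
  · rintro ⟨x, hx, h⟩
    obtain ⟨z, hz, h'⟩ := (mem_sourceOpens_iff_exists_links ha hW).1 hx
    rwa [((links_antipode_iff ha).1 h).target_unique h' ha]
  · intro hy
    have h := links_sourceMap ha (hW y hy).eq_one
    exact ⟨_, (mem_sourceOpens_iff_exists_links ha hW).2 ⟨y, hy, h⟩, h.antipode ha⟩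

theorem image_T_supportedIn (ha : a ∈ A.invariantWeaklyGrouplike) (hW : A.NormalizedOn a W) :
    A.T a '' supportedIn W = supportedIn (A.sourceOpens a W) := by
  refine Set.Subset.antisymm (Set.image_subset_iff.2 fun f hf => T_mem_supportedIn ha hW hf)
    fun g hg => ?_
  have hV := normalizedOn_sourceOpens ha hW
  refine ⟨A.T (A.antipode a) g, ?_, ?_⟩
  · have hmem := T_mem_supportedIn (antipode_mem_invariantWeaklyGrouplike ha) hV hg
    rwa [sourceOpens_antipode_sourceOpens ha hW] at hmem
  · rw [T_T_antipode ha, mul_comm _ g, hV.mul_counit hg, hV.mul_counit hg]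

theorem isInduced_targetDiffeomorph (ha : a ∈ A.invariantWeaklyGrouplike)
    (hW : A.NormalizedOn a W) :
    A.IsInduced a W (A.sourceOpens a W) (targetDiffeomorph ha hW) :=
  ⟨image_T_supportedIn ha hW, fun f _ x => (links_targetDiffeomorph ha hW x).T_eq ha f⟩

theorem IsInduced.links {τ : Diffeomorph 𝓘(ℝ, E) 𝓘(ℝ, E) V W ∞} (h : A.IsInduced a W V τ)
    (ha : a ∈ A.invariantWeaklyGrouplike) (hW : A.NormalizedOn a W) (x : V) :
    A.Links a x (τ x) := by
  obtain ⟨f, hf, hfW⟩ := exists_germOne_supportedIn 𝕜 E (τ x).2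
  have hx : (x : M) ∈ A.sourceOpens a W :=
    mem_sourceOpens.2 ⟨f, hfW, by rw [h.apply_eq f hfW, hf.eq_one]; exact one_ne_zero⟩
  obtain ⟨y, hy, hl⟩ := (mem_sourceOpens_iff_exists_links ha hW).1 hx
  have hyx : y = τ x := eq_of_forall_mem_supportedIn 𝕜 E hy fun g hg => by
    rw [← hl.T_eq ha, h.apply_eq g hg]
  rwa [← hyx]

theorem existsUnique_isInduced (ha : a ∈ A.invariantWeaklyGrouplike)
    (hW : A.NormalizedOn a W) :
    ∃! p : (V : Opens M) × Diffeomorph 𝓘(ℝ, E) 𝓘(ℝ, E) V W ∞, A.IsInduced a W p.1 p.2 := by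
  have h₀ := isInduced_targetDiffeomorph ha hW
  refine ⟨⟨_, targetDiffeomorph ha hW⟩, h₀, ?_⟩
  rintro ⟨V, τ⟩ h
  obtain rfl : V = A.sourceOpens a W :=
    supportedIn_injective 𝕜 E (h.image_eq.symm.trans h₀.image_eq)
  congr 1
  refine Diffeomorph.ext fun x => Subtype.ext ?_
  exact (h.links ha hW x).target_unique (links_targetDiffeomorph ha hW x) ha

end InducedDiffeomorphism

end Stalks

end HopfAlgebroid

namespace HopfAlgebroid

open SmoothCc

variable {𝕜 : Type*} [RCLike 𝕜] {E : Type*} [NormedAddCommGroup E] [NormedSpace ℝ E]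
  [FiniteDimensional ℝ E] {M : Type u} [TopologicalSpace M] [T2Space M] [ChartedSpace E M]
  [IsManifold 𝓘(ℝ, E) ∞ M]
  {A B C : HopfAlgebroid.{v} 𝕜 (SmoothCc 𝕜 E M)} {a b : A.carrier} {x y : M}

section SheafTopology

theorem germ_mem_grouplike (ha : a ∈ A.weaklyGrouplike) (hn : A.NormalizedAt a y) :
    A.germ y a ∈ A.grouplike y := by
  obtain ⟨a', ha⟩ := ha
  have ha' : A.germ y a' = A.germ y a := by rw [← germ_ι_mul hn a', ι_counit_mul_snd ha]
  refine ⟨?_, Germ.coe_eq.2 hn⟩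
  calc A.germTensor y (A.comul a)
      = BalancedTensor.tmul (A.stalkAct y) (A.germ y a) (A.germ y a') := by rw [ha]; rfl
    _ = BalancedTensor.tmul (A.stalkAct y) (A.germ y a) (A.germ y a) := by rw [ha']

theorem isOpen_basicSet (ha : a ∈ A.weaklyGrouplike) {W : Opens M} (hW : A.NormalizedOn a W) :
    IsOpen (A.basicSet a W) :=
  isOpen_generateFrom_of_mem ⟨a, W, ha, hW, rfl⟩

theorem exists_basicSet_subset {s : Set A.SpectralSheaf} (hs : IsOpen s) {ζ : A.SpectralSheaf}
    (hζ : ζ ∈ s) (ha : ζ.val = A.germ ζ.proj a) :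
    ∃ W : Opens M, ζ.proj ∈ W ∧ A.basicSet a W ⊆ s := by
  induction hs with
  | basic s hs =>
    obtain ⟨c, W, -, -, rfl⟩ := hs
    obtain ⟨hζW, hc⟩ := hζ
    obtain ⟨t, ht, hto, hζt⟩ := eventually_nhds_iff.1 (eventually_germ_eq (ha.symm.trans hc))
    refine ⟨W ⊓ ⟨t, hto⟩, ⟨hζW, hζt⟩, ?_⟩
    rintro ξ ⟨⟨hξW, hξt⟩, hξ⟩
    exact ⟨hξW, hξ.trans (ht _ hξt)⟩
  | univ => exact ⟨⊤, trivial, Set.subset_univ _⟩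
  | inter s t _ _ ihs iht =>
    obtain ⟨V, hV, hVs⟩ := ihs hζ.1
    obtain ⟨W, hW, hWt⟩ := iht hζ.2
    exact ⟨V ⊓ W, ⟨hV, hW⟩, fun ξ h => ⟨hVs ⟨h.1.1, h.2⟩, hWt ⟨h.1.2, h.2⟩⟩⟩
  | sUnion S _ ih =>
    obtain ⟨s, hs, hζs⟩ := hζ
    obtain ⟨W, hW, h⟩ := ih s hs hζs
    exact ⟨W, hW, h.trans (Set.subset_sUnion_of_mem hs)⟩

theorem isOpen_arrows : IsOpen A.arrows := by
  refine isOpen_iff_forall_mem_open.2 ?_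
  rintro ζ ⟨a, ha, hn, hζ⟩
  exact ⟨A.basicSet a (A.normalizedOpens a), fun ξ hξ => ⟨a, ha, hξ.1, hξ.2⟩,
    isOpen_basicSet (invariantWeaklyGrouplike_subset ha) (normalizedOn_normalizedOpens a), hn, hζ⟩

theorem isTopologicalBasis_basicSet :
    IsTopologicalBasis {s : Set A.Gsp | ∃ a ∈ A.invariantWeaklyGrouplike, ∃ W : Opens M,
      A.NormalizedOn a W ∧ s = Subtype.val ⁻¹' A.basicSet a W} := by
  refine isTopologicalBasis_of_isOpen_of_nhds ?_ ?_
  · rintro _ ⟨a, ha, W, hW, rfl⟩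
    exact (isOpen_basicSet (invariantWeaklyGrouplike_subset ha) hW).preimage
      continuous_subtype_val
  · rintro g _ hg ⟨s, hs, rfl⟩
    obtain ⟨a, ha, hn, h⟩ := g.2
    obtain ⟨W, hW, hWs⟩ := exists_basicSet_subset hs hg h
    exact ⟨_, ⟨a, ha, W ⊓ A.normalizedOpens a, fun x hx => hx.2, rfl⟩, ⟨⟨hW, hn⟩, h⟩,
      fun g' hg' => hWs ⟨hg'.1.1, hg'.2⟩⟩

end SheafTopology

namespace Gsp

section Arrows

/-- The arrow `a_y`. -/
def ofElement (ha : a ∈ A.invariantWeaklyGrouplike) (hn : A.NormalizedAt a y) : A.Gsp :=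
  ⟨⟨y, A.germ y a, germ_mem_grouplike (invariantWeaklyGrouplike_subset ha) hn⟩,
    a, ha, hn, rfl⟩

/-- The target of an arrow: the target of `a_y` is `y`. -/
def target (g : A.Gsp) : M := g.1.proj

theorem isRepresentedBy_ofElement (ha : a ∈ A.invariantWeaklyGrouplike)
    (hn : A.NormalizedAt a y) : (ofElement ha hn).IsRepresentedBy a :=
  ⟨ha, hn, rfl⟩

theorem exists_isRepresentedBy (g : A.Gsp) : ∃ a, g.IsRepresentedBy a := g.2

theorem ext_of_germ_eq {g h : A.Gsp} (hgh : g.target = h.target) (hg : g.IsRepresentedBy a)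
    (hh : h.IsRepresentedBy b) (hab : A.germ g.target a = A.germ g.target b) : g = h := by
  obtain ⟨⟨x, ζ, _⟩, _⟩ := g
  obtain ⟨⟨y, ξ, _⟩, _⟩ := h
  obtain rfl : x = y := hgh
  obtain rfl : ζ = ξ := hg.2.2.trans (hab.trans hh.2.2.symm)
  rfl

theorem ext_of_isRepresentedBy {g h : A.Gsp} (hgh : g.target = h.target)
    (hg : g.IsRepresentedBy a) (hh : h.IsRepresentedBy a) : g = h :=
  ext_of_germ_eq hgh hg hh rfl

theorem IsRepresentedBy.germ_eq {g : A.Gsp} (ha : g.IsRepresentedBy a)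
    (hb : g.IsRepresentedBy b) : A.germ g.target a = A.germ g.target b :=
  ha.2.2.symm.trans hb.2.2

theorem IsRepresentedBy.congr {g : A.Gsp} (ha : g.IsRepresentedBy a)
    (hb : b ∈ A.invariantWeaklyGrouplike) (h : A.germ g.target a = A.germ g.target b) :
    g.IsRepresentedBy b :=
  ⟨hb, ha.2.1.congr h, ha.2.2.trans h⟩

theorem IsRepresentedBy.map {g : A.Gsp} (ha : g.IsRepresentedBy a) (α : A ⟶ B) :
    (map α g).IsRepresentedBy (Hom.toAlgHom α a) := by
  refine ⟨Hom.map_invariantWeaklyGrouplike α ha.1, ?_, congrArg (stalkMap α g.target) ha.2.2⟩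
  rw [NormalizedAt, Hom.counit_map]
  exact ha.2.1

end Arrows

section Smooth

theorem IsRepresentedBy.eventually {g : A.Gsp} (ha : g.IsRepresentedBy a) :
    ∀ᶠ h in 𝓝 g, h.IsRepresentedBy a := by
  have hbasic := isTopologicalBasis_basicSet.isOpen
    ⟨a, ha.1, A.normalizedOpens a, normalizedOn_normalizedOpens a, rfl⟩
  filter_upwards [hbasic.mem_nhds ha.2] with h hh
  exact ⟨ha.1, hh⟩

theorem continuousAt_of_eventually {Z : Type*} [TopologicalSpace Z] {f : Z → A.Gsp} {z : Z}
    (hf : ContinuousAt (fun w => (f w).target) z)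
    (h : ∀ᶠ w in 𝓝 z, (f w).IsRepresentedBy a) : ContinuousAt f z := by
  intro u hu
  obtain ⟨_, htu, ⟨s, hs, rfl⟩, hzs⟩ := mem_nhds_iff.1 hu
  obtain ⟨W, hW, hWs⟩ := exists_basicSet_subset hs hzs h.self_of_nhds.2.2
  have hfW : ∀ᶠ w in 𝓝 z, (f w).target ∈ W := hf.eventually (W.isOpen.mem_nhds hW)
  exact (h.and hfW).mono fun w hw => htu (hWs ⟨hw.2, hw.1.2.2⟩)

theorem continuous_target : Continuous (target : A.Gsp → M) := by
  refine continuous_iff_continuousAt.2 fun g => ?_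
  intro U hU
  obtain ⟨V, hVU, hV, hgV⟩ := mem_nhds_iff.1 hU
  obtain ⟨a, ha⟩ := g.exists_isRepresentedBy
  have hbasic := isTopologicalBasis_basicSet.isOpen
    ⟨a, ha.1, ⟨V, hV⟩ ⊓ A.normalizedOpens a, fun x hx => hx.2, rfl⟩
  refine mem_map.2 ?_
  filter_upwards [hbasic.mem_nhds ⟨⟨hgV, ha.2.1⟩, ha.2.2⟩] with h hh
  exact hVU hh.1.1

theorem isOpenMap_target : IsOpenMap (target : A.Gsp → M) := by
  refine isTopologicalBasis_basicSet.isOpenMap_iff.2 ?_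
  rintro _ ⟨a, ha, W, hW, rfl⟩
  suffices h : target '' (Subtype.val ⁻¹' A.basicSet a W : Set A.Gsp) = W from h ▸ W.isOpen
  refine Set.Subset.antisymm (Set.image_subset_iff.2 fun g hg => hg.1) fun y hy => ?_
  exact ⟨ofElement ha (hW y hy), ⟨hy, rfl⟩, rfl⟩

theorem isLocallyInjective_target : IsLocallyInjective (target : A.Gsp → M) := by
  refine isLocallyInjective_iff_nhds.2 fun g => ?_
  obtain ⟨a, ha⟩ := g.exists_isRepresentedBy
  exact ⟨_, ha.eventually, fun _ hg _ hh hgh => ext_of_isRepresentedBy hgh hg hh⟩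

theorem isLocalHomeomorph_target : IsLocalHomeomorph (target : A.Gsp → M) :=
  isLocalHomeomorph_of_isOpenMap continuous_target isOpenMap_target isLocallyInjective_target

instance : ChartedSpace E A.Gsp := pullbackChartedSpace isLocalHomeomorph_target

instance : IsManifold 𝓘(ℝ, E) ∞ A.Gsp := isManifold_pullback isLocalHomeomorph_target _ _

theorem isLocalDiffeomorph_target :
    IsLocalDiffeomorph 𝓘(ℝ, E) 𝓘(ℝ, E) ∞ (target : A.Gsp → M) :=
  isLocalDiffeomorph_pullback isLocalHomeomorph_target _ _

end Smooth

section Source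

/-- The source of an arrow, read off from any representative. -/
def source (g : A.Gsp) : M := A.sourceMap g.exists_isRepresentedBy.choose g.target

theorem IsRepresentedBy.links {g : A.Gsp} (ha : g.IsRepresentedBy a) :
    A.Links a g.source g.target := by
  have h := g.exists_isRepresentedBy.choose_spec
  exact (links_sourceMap h.1 h.2.1.eq_one).congr (h.germ_eq ha)

theorem isLocalDiffeomorph_source :
    IsLocalDiffeomorph 𝓘(ℝ, E) 𝓘(ℝ, E) ∞ (source : A.Gsp → M) := by
  intro g
  obtain ⟨a, ha⟩ := g.exists_isRepresentedBy
  have h := (isLocalDiffeomorph_target g).comp 𝓘(ℝ, E) _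
    ⟨sourcePartialDiffeomorph ha.1 (normalizedOn_normalizedOpens a), ha.2.1, fun _ _ => rfl⟩
  refine isLocalDiffeomorphAt_congr h ?_
  filter_upwards [ha.eventually] with g' hg'
  exact hg'.links.sourceMap_eq.symm

theorem continuous_source : Continuous (source : A.Gsp → M) :=
  isLocalDiffeomorph_source.contMDiff.continuous

theorem source_map (α : A ⟶ B) (g : A.Gsp) : (map α g).source = g.source := by
  obtain ⟨a, ha⟩ := g.exists_isRepresentedBy
  exact (ha.map α).links.source_unique (ha.links.map α)

end Source

section Unit

variable (A) in
/-- The unit arrow at `y`, represented by any function which equals `1` near `y`. -/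
def unit (y : M) : A.Gsp :=
  ofElement (ι_mem_invariantWeaklyGrouplike (exists_germOne_at 𝕜 E y).choose)
    (normalizedAt_ι (exists_germOne_at 𝕜 E y).choose_spec)

theorem isRepresentedBy_unit {f : SmoothCc 𝕜 E M} (hf : GermOne f y) :
    (unit A y).IsRepresentedBy (A.ι f) :=
  (isRepresentedBy_ofElement _ _).congr (ι_mem_invariantWeaklyGrouplike f)
    (germ_ι_eq (exists_germOne_at 𝕜 E y).choose_spec hf)

theorem source_unit (y : M) : (unit A y).source = y := by
  obtain ⟨f, hf⟩ := exists_germOne_at 𝕜 E y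
  exact (isRepresentedBy_unit hf).links.source_unique (links_ι hf.eq_one)

theorem continuous_unit : Continuous (unit A) := by
  refine continuous_iff_continuousAt.2 fun y => ?_
  obtain ⟨f, hf⟩ := exists_germOne_at 𝕜 E y
  refine continuousAt_of_eventually (a := A.ι f) continuousAt_id ?_
  filter_upwards [eventually_eventually_nhds.2 hf] with z hz
  exact isRepresentedBy_unit hz

theorem map_unit (α : A ⟶ B) (y : M) : map α (unit A y) = unit B y := by
  obtain ⟨f, hf⟩ := exists_germOne_at 𝕜 E y
  refine ext_of_isRepresentedBy rfl ((isRepresentedBy_unit hf).map α) ?_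
  rw [Hom.map_ι]
  exact isRepresentedBy_unit hf

end Unit

section Inverse

theorem IsRepresentedBy.normalizedAt_antipode {g : A.Gsp} (ha : g.IsRepresentedBy a) :
    A.NormalizedAt (A.antipode a) g.source :=
  ha.links.normalizedAt_antipode ha.1 ha.2.1

/-- The inverse of an arrow: if `x` is the source of `a_y`, the inverse of `a_y` is `(S a)_x`. -/
def inv (g : A.Gsp) : A.Gsp :=
  ofElement (antipode_mem_invariantWeaklyGrouplike g.exists_isRepresentedBy.choose_spec.1)
    g.exists_isRepresentedBy.choose_spec.normalizedAt_antipode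

theorem IsRepresentedBy.inv {g : A.Gsp} (ha : g.IsRepresentedBy a) :
    g.inv.IsRepresentedBy (A.antipode a) := by
  have h := g.exists_isRepresentedBy.choose_spec
  exact (isRepresentedBy_ofElement _ h.normalizedAt_antipode).congr
    (antipode_mem_invariantWeaklyGrouplike ha.1)
    (h.links.germ_antipode_congr h.1 h.2.1 ha.1 (h.germ_eq ha))

theorem source_inv (g : A.Gsp) : g.inv.source = g.target := by
  obtain ⟨a, ha⟩ := g.exists_isRepresentedBy
  exact ha.inv.links.source_unique (ha.links.antipode ha.1)

theorem continuous_inv : Continuous (inv : A.Gsp → A.Gsp) := by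
  refine continuous_iff_continuousAt.2 fun g => ?_
  obtain ⟨a, ha⟩ := g.exists_isRepresentedBy
  exact continuousAt_of_eventually continuous_source.continuousAt
    (ha.eventually.mono fun _ hg => hg.inv)

end Inverse

section Product

variable (A) in
/-- The space of pairs `(h, g)` of arrows for which the product `h g` is defined. -/
abbrev Composable : Type (max u v) := {p : A.Gsp × A.Gsp // p.1.source = p.2.target}

theorem IsRepresentedBy.links_of_source_eq {h : A.Gsp} (hb : h.IsRepresentedBy b)
    (hy : h.source = y) : A.Links b y h.target :=
  hy ▸ hb.links

theorem IsRepresentedBy.normalizedAt_mul {h g : A.Gsp} (hb : h.IsRepresentedBy b)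
    (ha : g.IsRepresentedBy a) (hhg : h.source = g.target) :
    A.NormalizedAt (b * a) h.target :=
  (hb.links_of_source_eq hhg).normalizedAt_mul hb.1 ha.1 hb.2.1 ha.2.1

/-- The product of composable arrows: `b_z a_y = (b a)_z`. -/
def mul (p : Composable A) : A.Gsp :=
  ofElement (mul_mem_invariantWeaklyGrouplike p.1.1.exists_isRepresentedBy.choose_spec.1
      p.1.2.exists_isRepresentedBy.choose_spec.1)
    (p.1.1.exists_isRepresentedBy.choose_spec.normalizedAt_mul
      p.1.2.exists_isRepresentedBy.choose_spec p.2)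

theorem IsRepresentedBy.mul {p : Composable A} (hb : p.1.1.IsRepresentedBy b)
    (ha : p.1.2.IsRepresentedBy a) : (mul p).IsRepresentedBy (b * a) := by
  have hb₀ := p.1.1.exists_isRepresentedBy.choose_spec
  have ha₀ := p.1.2.exists_isRepresentedBy.choose_spec
  refine (isRepresentedBy_ofElement _ (hb₀.normalizedAt_mul ha₀ p.2)).congr
    (mul_mem_invariantWeaklyGrouplike hb.1 ha.1) ?_
  exact ((hb₀.links_of_source_eq p.2).germ_mul_congr_right hb₀.1 hb₀.2.1 (ha₀.germ_eq ha)).trans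
    (germ_mul_congr_left (hb₀.germ_eq hb) a)

theorem source_mul (p : Composable A) : (mul p).source = p.1.2.source := by
  obtain ⟨b, hb⟩ := p.1.1.exists_isRepresentedBy
  obtain ⟨a, ha⟩ := p.1.2.exists_isRepresentedBy
  exact (hb.mul ha).links.source_unique
    ((hb.links_of_source_eq p.2).mul ha.links hb.1 ha.1)

theorem continuous_composableFst : Continuous fun p : Composable A => p.1.1 :=
  continuous_fst.comp continuous_subtype_val

theorem continuous_composableSnd : Continuous fun p : Composable A => p.1.2 :=
  continuous_snd.comp continuous_subtype_val

theorem continuous_mul : Continuous (mul : Composable A → A.Gsp) := by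
  refine continuous_iff_continuousAt.2 fun p => ?_
  obtain ⟨b, hb⟩ := p.1.1.exists_isRepresentedBy
  obtain ⟨a, ha⟩ := p.1.2.exists_isRepresentedBy
  refine continuousAt_of_eventually (a := b * a)
    (continuous_target.comp continuous_composableFst).continuousAt ?_
  filter_upwards [continuous_composableFst.continuousAt.eventually hb.eventually,
    continuous_composableSnd.continuousAt.eventually ha.eventually] with q hqb hqa
  exact hqb.mul hqa

theorem map_mul (α : A ⟶ B) (p : Composable A) {q : Composable B}
    (hfst : q.1.1 = map α p.1.1) (hsnd : q.1.2 = map α p.1.2) :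
    map α (mul p) = mul q := by
  obtain ⟨b, hb⟩ := p.1.1.exists_isRepresentedBy
  obtain ⟨a, ha⟩ := p.1.2.exists_isRepresentedBy
  have hq : (mul q).IsRepresentedBy (Hom.toAlgHom α b * Hom.toAlgHom α a) :=
    .mul (hfst ▸ hb.map α) (hsnd ▸ ha.map α)
  rw [← _root_.map_mul] at hq
  exact ext_of_isRepresentedBy (congrArg target hfst).symm ((hb.mul ha).map α) hq

theorem mul_assoc (g h k : A.Gsp) (hgh : g.source = h.target) (hhk : h.source = k.target) :
    mul ⟨(mul ⟨(g, h), hgh⟩, k), (source_mul _).trans hhk⟩ =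
      mul ⟨(g, mul ⟨(h, k), hhk⟩), hgh⟩ := by
  obtain ⟨a, ha⟩ := g.exists_isRepresentedBy
  obtain ⟨b, hb⟩ := h.exists_isRepresentedBy
  obtain ⟨c, hc⟩ := k.exists_isRepresentedBy
  refine ext_of_isRepresentedBy (a := a * (b * c)) rfl ?_ (.mul ha (.mul hb hc))
  rw [← _root_.mul_assoc]
  exact .mul (.mul ha hb) hc

theorem unit_mul (g : A.Gsp) : mul ⟨(unit A g.target, g), source_unit _⟩ = g := by
  obtain ⟨a, ha⟩ := g.exists_isRepresentedBy
  obtain ⟨f, hf⟩ := exists_germOne_at 𝕜 E g.target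
  exact ext_of_germ_eq rfl (.mul (isRepresentedBy_unit hf) ha) ha (germ_ι_mul hf a)

theorem mul_unit (g : A.Gsp) : mul ⟨(g, unit A g.source), rfl⟩ = g := by
  obtain ⟨a, ha⟩ := g.exists_isRepresentedBy
  obtain ⟨f, hf⟩ := exists_germOne_at 𝕜 E g.source
  exact ext_of_germ_eq rfl (.mul ha (isRepresentedBy_unit hf)) ha
    (ha.links.germ_mul_ι ha.1 ha.2.1 hf)

theorem IsRepresentedBy.isRepresentedBy_unit_target {g : A.Gsp} (ha : g.IsRepresentedBy a) :
    (unit A g.target).IsRepresentedBy (a * A.antipode a) := by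
  rw [self_mul_antipode ha.1]
  exact isRepresentedBy_unit (GermOne.mul ha.2.1 ha.2.1)

theorem mul_inv (g : A.Gsp) : mul ⟨(g, g.inv), rfl⟩ = unit A g.target := by
  obtain ⟨a, ha⟩ := g.exists_isRepresentedBy
  exact ext_of_isRepresentedBy rfl (.mul ha ha.inv) ha.isRepresentedBy_unit_target

theorem inv_mul (g : A.Gsp) : mul ⟨(g.inv, g), source_inv g⟩ = unit A g.source := by
  obtain ⟨a, ha⟩ := g.exists_isRepresentedBy
  have hunit := ha.inv.isRepresentedBy_unit_target
  rw [A.antipode_antipode] at hunit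
  exact ext_of_isRepresentedBy rfl (.mul ha.inv ha) hunit

theorem exists_isLocalDiffeomorph_mul : ∃ _ : ChartedSpace E (Composable A),
    IsManifold 𝓘(ℝ, E) ∞ (Composable A) ∧
    IsLocalDiffeomorph 𝓘(ℝ, E) 𝓘(ℝ, E) ∞ (fun p : Composable A => p.1.1) ∧
    IsLocalDiffeomorph 𝓘(ℝ, E) 𝓘(ℝ, E) ∞ (fun p : Composable A => p.1.2) ∧
    IsLocalDiffeomorph 𝓘(ℝ, E) 𝓘(ℝ, E) ∞ (mul : Composable A → A.Gsp) := by
  have hfst : IsLocalHomeomorph fun p : Composable A => p.1.1 :=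
    isLocalHomeomorph_fst_fibredProduct continuous_source isLocalHomeomorph_target
  let : ChartedSpace E (Composable A) := pullbackChartedSpace hfst
  have hfst_diffeo := isLocalDiffeomorph_pullback hfst 𝓘(ℝ, E) ∞
  refine ⟨this, isManifold_pullback hfst _ _, hfst_diffeo, ?_, ?_⟩
  · refine isLocalDiffeomorph_of_comp isLocalDiffeomorph_target continuous_composableSnd ?_
    have h := isLocalDiffeomorph_comp isLocalDiffeomorph_source hfst_diffeo
    rwa [funext fun p : Composable A => p.2] at h
  · have h := isLocalDiffeomorph_comp isLocalDiffeomorph_target hfst_diffeo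
    exact isLocalDiffeomorph_of_comp isLocalDiffeomorph_target continuous_mul h

end Product

section Groupoid

variable (A) in
/-- The étale Lie groupoid of arrows of a Hopf algebroid. -/
def spectralGroupoid : EtaleLieGroupoid E M A.Gsp where
  source := source
  target := target
  unit := unit A
  inv := inv
  mul := mul
  source_unit := source_unit
  target_unit _ := rfl
  source_inv := source_inv
  target_inv _ := rfl
  source_mul := source_mul
  target_mul _ := rfl
  mul_assoc := mul_assoc
  unit_mul := unit_mul
  mul_unit := mul_unit
  inv_mul := inv_mul
  mul_inv := mul_inv
  source_localDiffeo := isLocalDiffeomorph_source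
  target_localDiffeo := isLocalDiffeomorph_target
  unit_localDiffeo :=
    isLocalDiffeomorph_of_comp isLocalDiffeomorph_target continuous_unit isLocalDiffeomorph_id
  inv_localDiffeo :=
    isLocalDiffeomorph_of_comp isLocalDiffeomorph_target continuous_inv isLocalDiffeomorph_source
  mul_localDiffeo := exists_isLocalDiffeomorph_mul

theorem isSpectralGroupoid : A.IsSpectralGroupoid (spectralGroupoid A) where
  target_eq _ := rfl
  source_eq g a ha W V τ hW hτ hg := by
    have h := hτ.links ha.1 hW (τ.symm ⟨g.1.proj, hg⟩)
    rw [τ.apply_symm_apply] at h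
    exact ha.links.source_unique h
  unit_eq _ _ hf := isRepresentedBy_unit hf
  mul_eq _ _ _ _ _ hb ha := .mul hb ha
  inv_eq _ _ ha := ha.inv

end Groupoid

section Functoriality

theorem continuous_map (α : A ⟶ B) : Continuous (map α) := by
  refine continuous_iff_continuousAt.2 fun g => ?_
  obtain ⟨a, ha⟩ := g.exists_isRepresentedBy
  exact continuousAt_of_eventually continuous_target.continuousAt
    (ha.eventually.mono fun _ hg => hg.map α)

theorem isMorphism_map (α : A ⟶ B) :
    (spectralGroupoid A).IsMorphism (spectralGroupoid B) (map α) where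
  smooth := (isLocalDiffeomorph_of_comp isLocalDiffeomorph_target (continuous_map α)
    isLocalDiffeomorph_target).contMDiff
  map_unit := map_unit α
  source_map := source_map α
  target_map _ := rfl
  map_mul _ _ _ := map_mul α _ rfl rfl

theorem map_id (g : A.Gsp) : map (𝟙 A) g = g := by
  obtain ⟨a, ha⟩ := g.exists_isRepresentedBy
  exact ext_of_isRepresentedBy rfl (ha.map (𝟙 A)) ha

theorem map_comp (α : A ⟶ B) (β : B ⟶ C) (g : A.Gsp) : map (α ≫ β) g = map β (map α g) := by
  obtain ⟨a, ha⟩ := g.exists_isRepresentedBy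
  exact ext_of_isRepresentedBy rfl (ha.map (α ≫ β)) ((ha.map α).map β)

variable (𝕜 E M) in
/-- The functor which assigns to a Hopf algebroid its étale Lie groupoid of arrows. -/
def spectralFunctor : HopfAlgebroid.{v} 𝕜 (SmoothCc 𝕜 E M) ⥤ EtGrpd.{max u v} E M where
  obj A := { Arr := A.Gsp, groupoid := spectralGroupoid A }
  map α := ⟨map α, isMorphism_map α⟩
  map_id _ := Subtype.ext (funext map_id)
  map_comp α β := Subtype.ext (funext (map_comp α β))

end Functoriality

end Gsp

end HopfAlgebroid

end

theorem theorem24 {𝕜 : Type*} [RCLike 𝕜] {E : Type*} [NormedAddCommGroup E] [NormedSpace ℝ E]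
    [FiniteDimensional ℝ E] {M : Type u} [TopologicalSpace M] [T2Space M] [ChartedSpace E M]
    [IsManifold 𝓘(ℝ, E) ∞ M] :
    -- the diffeomorphisms `τ_{W,a}` exist and are unique
    (∀ (A : HopfAlgebroid.{v} 𝕜 (SmoothCc 𝕜 E M)), ∀ a ∈ A.invariantWeaklyGrouplike,
      ∀ W : Opens M, A.NormalizedOn a W →
        ∃! p : (V : Opens M) × Diffeomorph 𝓘(ℝ, E) 𝓘(ℝ, E) V W ∞, A.IsInduced a W p.1 p.2) ∧
    -- the arrows form a subsheaf of the spectral sheaf, with the basis of the sets `a_W`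
    (∀ (A : HopfAlgebroid.{v} 𝕜 (SmoothCc 𝕜 E M)),
      IsOpen A.arrows ∧
      IsTopologicalBasis {s : Set A.Gsp | ∃ a ∈ A.invariantWeaklyGrouplike, ∃ W : Opens M,
        A.NormalizedOn a W ∧ s = Subtype.val ⁻¹' A.basicSet a W} ∧
      ∀ a ∈ A.invariantWeaklyGrouplike, ∀ y : M, A.NormalizedAt a y →
        ∃ g : A.Gsp, g.1.proj = y ∧ g.IsRepresentedBy a) ∧
    -- the sheaf of arrows is an étale Lie groupoid, functorially in the Hopf algebroid
    ∃ 𝒢 : ∀ A : HopfAlgebroid.{v} 𝕜 (SmoothCc 𝕜 E M), EtaleLieGroupoid E M A.Gsp,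
      (∀ A : HopfAlgebroid.{v} 𝕜 (SmoothCc 𝕜 E M), A.IsSpectralGroupoid (𝒢 A)) ∧
      ∃ hmap : ∀ {A B : HopfAlgebroid.{v} 𝕜 (SmoothCc 𝕜 E M)} (α : A ⟶ B),
          (𝒢 A).IsMorphism (𝒢 B) (HopfAlgebroid.Gsp.map α),
        ∃ F : HopfAlgebroid.{v} 𝕜 (SmoothCc 𝕜 E M) ⥤ EtGrpd.{max u v} E M,
          F.toPrefunctor =
            { obj := fun A => { Arr := A.Gsp, groupoid := 𝒢 A }
              map := fun α => ⟨HopfAlgebroid.Gsp.map α, hmap α⟩ } := by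
  exact ⟨fun A a ha W hW => HopfAlgebroid.existsUnique_isInduced ha hW,
    fun A => ⟨HopfAlgebroid.isOpen_arrows, HopfAlgebroid.isTopologicalBasis_basicSet,
      fun a ha y hn => ⟨HopfAlgebroid.Gsp.ofElement ha hn, rfl,
        HopfAlgebroid.Gsp.isRepresentedBy_ofElement ha hn⟩⟩,
    HopfAlgebroid.Gsp.spectralGroupoid, fun A => HopfAlgebroid.Gsp.isSpectralGroupoid,
    HopfAlgebroid.Gsp.isMorphism_map, HopfAlgebroid.Gsp.spectralFunctor 𝕜 E M, rfl⟩
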